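/- Let $a>0$, $p_0\in[0.5,1]$, and let $y_1,y_2,\dots$ be i.i.d. draws from the mixture $p_0\,\mathrm{Cauchy}(a,1)+(1-p_0)\,\mathrm{Cauchy}(-a,1)$. Fit the model $y_i\sim\mathrm{Cauchy}(\mu,1)$ i.i.d., $\mu\in\mathbb R$, with a prior on $\mu$ that has full support on $\mathbb R$ (it charges every non-empty open set). The prior may be improper (for instance flat), provided that it yields a proper posterior for all large $n$, i.e. $\int(1+|\mu|)^{-m}\,\mathrm{prior}(d\mu)<\infty$ for some $m$; this holds for every proper prior. Let $\Pr(\cdot\mid y_{1:n})$ be the posterior, proportional to $\prod_{i=1}^n\frac1{\pi(1+(y_i-\mu)^2)}\,\mathrm{prior}(d\mu)$. (a) If $a>2$ and $0.5<p_0\le 1$, there is a point $\gamma=\gamma(p_0,a)$, depending only on $p_0$ and $a$ and being the unique maximizer over $\mu$ of the expected log density $\mathrm E\log\frac{1}{\pi(1+(y_1-\mu)^2)}$, such that almost surely the posterior converges in distribution to the point mass $\delta_{\gamma}$ as $n\to\infty$. (b) If $a>2$, $p_0=0.5$, and the prior is symmetric under $\mu\mapsto-\mu$, then with $\gamma=\sqrt{a^2-4}$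 the posterior asymptotically charges only $\pm\gamma$: almost surely, for every $\eta>0$, $\Pr(|\mu-\gamma|<\eta\text{ or }|\mu+\gamma|<\eta\mid y_{1:n})\to1$. The two points are selected with equal probabilities $1/2$: for every $0<\eta<2\gamma$, each of the random variables $\Pr(|\mu-\gamma|<\eta\mid y_{1:n})$ and $\Pr(|\mu+\gamma|<\eta\mid y_{1:n})$ converges in distribution, as $n\to\infty$, to a Bernoulli$(1/2)$ variable. (c) Under the conditions of (b), almost surely, for every $\eta>0$, $$\limsup_{n\to\infty}\Pr\left(\left|\mu-\sqrt{a^2-4}\right|<\eta\mid y_{1:n}\right)=\limsup_{n\to\infty}\Pr\left(\left|\mu+\sqrt{a^2-4}\right|<\eta\mid y_{1:n}\right)=1,$$ so the posterior oscillates between the two points. -/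

import Mathlib

open MeasureTheory ProbabilityTheory Filter Topology

/-- The law of a single observation: the mixture `p₀ Cauchy(a, 1) + (1 - p₀) Cauchy(-a, 1)`. -/
noncomputable def cauchyMixture (a p₀ : ℝ) : Measure ℝ :=
  ENNReal.ofReal p₀ • cauchyMeasure a 1 + ENNReal.ofReal (1 - p₀) • cauchyMeasure (-a) 1

/-- `Y 0, Y 1, …` are i.i.d. draws from `p₀ Cauchy(a, 1) + (1 - p₀) Cauchy(-a, 1)`. -/
def IsCauchyMixtureSample {Ω : Type*} [MeasurableSpace Ω] (P : Measure Ω) (Y : ℕ → Ω → ℝ)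
    (a p₀ : ℝ) : Prop :=
  iIndepFun Y P ∧ ∀ i, HasLaw (Y i) (cauchyMixture a p₀) P

/-- The likelihood of `μ` in the model `y i ∼ Cauchy(μ, 1)`, i.i.d., given the first `n` terms of
the data sequence `y`. -/
noncomputable def cauchyLikelihood (y : ℕ → ℝ) (n : ℕ) (μ : ℝ) : ENNReal :=
  ∏ i ∈ Finset.range n, cauchyPDF μ 1 (y i)

/-- The posterior of `μ` given the first `n` terms of `y`: the prior reweighted by the likelihood,
divided by the normalizing constant. The prior may be improper; where the normalizing constant is
infinite (no proper posterior), this is the zero measure. -/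
noncomputable def cauchyPosterior (prior : Measure ℝ) (y : ℕ → ℝ) (n : ℕ) : Measure ℝ :=
  (∫⁻ μ, cauchyLikelihood y n μ ∂prior)⁻¹ • prior.withDensity (cauchyLikelihood y n)

/-- The expected log density `E log f(y | μ)` of the model `Cauchy(μ, 1)` when
`y ∼ p₀ Cauchy(a, 1) + (1 - p₀) Cauchy(-a, 1)`. -/
noncomputable def expectedLogDensity (a p₀ μ : ℝ) : ℝ :=
  ∫ y, Real.log (cauchyPDFReal μ 1 y) ∂cauchyMixture a p₀

/-! By the law of large numbers the average loss converges to the expected loss, and the posterior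
concentrates on the minimizers of the limit. The loss is 1-Lipschitz in the parameter for every
observation, so pointwise convergence is automatically locally uniform; and it dominates `log (1 + μ
^ 2)` up to a data term, which controls large `μ` and pays for an improper prior. This gives
`tendsto_cauchyPosterior_zero`. The expected loss under `Cauchy(b, 1)` is `log ((μ - b) ^ 2 + 4)` up
to a constant (`cauchyExpectedLoss_eq`), so finding the minimizers is algebra: one point for unequal
weights, `± √(a ^ 2 - 4)` for equal weights.

For equal weights, the log likelihood ratio of `γ` against `-γ` is a random walk with bounded,
centered, nondegenerate steps. By the central limit theorem it is of order `√n`, while its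
oscillation as the parameter runs over a small ball is a small multiple of `√n` with high
probability. Hence one of the two balls takes nearly all the mass
(`exists_eventually_measure_not_separated`). Reflection of data and prior exchanges the two
outcomes, so each has limiting probability 1/2.

For the oscillation, the event that the likelihood mass of the positive half-line exceeds that of
the negative one by unbounded factors is a tail event. Its probability is at least 1/2, hence 1 by
Kolmogorov's zero-one law; reflection gives the other point. -/

/-! ### Lipschitz and growth bounds for the Cauchy loss. -/

/-- The part `log (1 + (y - μ) ^ 2)` of the negative log density of `Cauchy(μ, 1)` at `y` that
depends on `μ`. -/
noncomputable def cauchyLoss (y μ : ℝ) : ℝ := Real.log (1 + (y - μ) ^ 2)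

/-- The sum of the losses of the first `n` terms of `y`. -/
noncomputable def totalLoss (y : ℕ → ℝ) (n : ℕ) (μ : ℝ) : ℝ :=
  ∑ i ∈ Finset.range n, cauchyLoss (y i) μ

lemma cauchyLoss_nonneg (y μ : ℝ) : 0 ≤ cauchyLoss y μ :=
  Real.log_nonneg (by nlinarith [sq_nonneg (y - μ)])

lemma continuous_cauchyLoss : Continuous fun p : ℝ × ℝ => cauchyLoss p.1 p.2 := by
  unfold cauchyLoss
  exact Continuous.log (by fun_prop) fun p => by positivity

lemma hasDerivAt_log_one_add_sq (x : ℝ) :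
    HasDerivAt (fun x : ℝ => Real.log (1 + x ^ 2)) (2 * x / (1 + x ^ 2)) x := by
  have h := ((hasDerivAt_id x).pow 2).const_add 1
  simpa using h.log (by simp only [id, Pi.pow_apply]; positivity)

lemma abs_two_mul_div_one_add_sq_le (x : ℝ) : |2 * x / (1 + x ^ 2)| ≤ 1 := by
  rw [abs_div, abs_of_pos (show 0 < 1 + x ^ 2 by positivity), div_le_one (by positivity), abs_le]
  constructor <;> nlinarith [sq_nonneg (x - 1), sq_nonneg (x + 1)]

lemma abs_log_one_add_sq_sub_le (x z : ℝ) :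
    |Real.log (1 + x ^ 2) - Real.log (1 + z ^ 2)| ≤ |x - z| := by
  have := Convex.norm_image_sub_le_of_norm_hasDerivWithin_le (s := Set.univ) (C := 1)
    (f := fun x : ℝ => Real.log (1 + x ^ 2)) (f' := fun x => 2 * x / (1 + x ^ 2))
    (fun x _ => (hasDerivAt_log_one_add_sq x).hasDerivWithinAt)
    (fun x _ => abs_two_mul_div_one_add_sq_le x) convex_univ
    (Set.mem_univ z) (Set.mem_univ x)
  simpa using this

/-- The score is bounded by 1 whatever the observation. This makes all average losses equi-Lipschitz
despite the heavy tails of the data. -/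
lemma abs_cauchyLoss_sub_le (y μ ν : ℝ) : |cauchyLoss y μ - cauchyLoss y ν| ≤ |μ - ν| := by
  refine (abs_log_one_add_sq_sub_le _ _).trans (le_of_eq ?_)
  rw [← abs_neg]; congr 1; ring

lemma abs_cauchyLoss_sub_le' (y z μ : ℝ) : |cauchyLoss y μ - cauchyLoss z μ| ≤ |y - z| := by
  refine (abs_log_one_add_sq_sub_le _ _).trans (le_of_eq ?_)
  congr 1; ring

lemma cauchyLoss_neg_neg (y μ : ℝ) : cauchyLoss (-y) (-μ) = cauchyLoss y μ := by
  unfold cauchyLoss; congr 2; ring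

/-- Logarithm of the Peetre-type inequality `1 + μ² ≤ 2 (1 + y²) (1 + (y - μ)²)`. It is the source
of all coercivity in `μ`. -/
lemma log_one_add_sq_le_cauchyLoss (y μ : ℝ) :
    Real.log (1 + μ ^ 2) - Real.log 2 - cauchyLoss y 0 ≤ cauchyLoss y μ := by
  unfold cauchyLoss
  have h : Real.log (1 + μ ^ 2) ≤ Real.log (2 * (1 + (y - 0) ^ 2) * (1 + (y - μ) ^ 2)) := by
    apply Real.log_le_log (by positivity)
    nlinarith [sq_nonneg (y - μ), sq_nonneg y, sq_nonneg (y * (y - μ)), sq_nonneg (2 * y - μ)]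
  rw [Real.log_mul (by positivity) (by positivity), Real.log_mul (by positivity) (by positivity)]
    at h
  linarith

lemma log_cauchyPDFReal (μ y : ℝ) :
    Real.log (cauchyPDFReal μ 1 y) = -Real.log Real.pi - cauchyLoss y μ := by
  have h : cauchyPDFReal μ 1 y = Real.pi⁻¹ * (1 + (y - μ) ^ 2)⁻¹ := by
    simp [cauchyPDFReal, add_comm]
  rw [h, Real.log_mul (by positivity) (by positivity), Real.log_inv, Real.log_inv, cauchyLoss]
  ring

lemma cauchyPDF_eq (μ y : ℝ) :
    cauchyPDF μ 1 y = ENNReal.ofReal (Real.pi⁻¹ * Real.exp (-cauchyLoss y μ)) := by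
  rw [cauchyPDF, ← Real.exp_log (cauchyPDF_pos μ one_ne_zero y), log_cauchyPDFReal, sub_eq_add_neg,
    Real.exp_add, Real.exp_neg, Real.exp_log Real.pi_pos]

lemma cauchyLikelihood_eq (y : ℕ → ℝ) (n : ℕ) (μ : ℝ) :
    cauchyLikelihood y n μ =
      ENNReal.ofReal (Real.pi⁻¹ ^ n * Real.exp (-totalLoss y n μ)) := by
  simp only [cauchyLikelihood, cauchyPDF_eq, totalLoss]
  rw [← ENNReal.ofReal_prod_of_nonneg (fun i _ => by positivity), Finset.prod_mul_distrib,
    Finset.prod_const, Finset.card_range, ← Real.exp_sum, Finset.sum_neg_distrib]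

lemma abs_totalLoss_sub_le (y : ℕ → ℝ) (n : ℕ) (μ ν : ℝ) :
    |totalLoss y n μ - totalLoss y n ν| ≤ n * |μ - ν| := by
  unfold totalLoss
  rw [← Finset.sum_sub_distrib]
  refine (Finset.abs_sum_le_sum_abs _ _).trans ?_
  refine (Finset.sum_le_sum fun i _ => abs_cauchyLoss_sub_le (y i) μ ν).trans ?_
  simp

lemma continuous_totalLoss (n : ℕ) :
    Continuous fun p : (ℕ → ℝ) × ℝ => totalLoss p.1 n p.2 := by
  unfold totalLoss
  exact continuous_finsetSum _ fun i _ =>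
    continuous_cauchyLoss.comp (by fun_prop : Continuous fun p : (ℕ → ℝ) × ℝ => (p.1 i, p.2))

lemma continuous_totalLoss_right (y : ℕ → ℝ) (n : ℕ) : Continuous (totalLoss y n) :=
  (continuous_totalLoss n).comp (by fun_prop : Continuous fun μ : ℝ => (y, μ))

lemma measurable_cauchyLikelihood_uncurry (n : ℕ) :
    Measurable fun p : (ℕ → ℝ) × ℝ => cauchyLikelihood p.1 n p.2 := by
  simp only [cauchyLikelihood_eq]
  have := continuous_totalLoss n
  exact (by fun_prop : Continuous fun p : (ℕ → ℝ) × ℝ =>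
    Real.pi⁻¹ ^ n * Real.exp (-totalLoss p.1 n p.2)).measurable.ennreal_ofReal

lemma measurable_cauchyLikelihood (y : ℕ → ℝ) (n : ℕ) : Measurable (cauchyLikelihood y n) := by
  have h := continuous_totalLoss_right y n
  have h' : cauchyLikelihood y n = fun μ =>
      ENNReal.ofReal (Real.pi⁻¹ ^ n * Real.exp (-totalLoss y n μ)) :=
    funext (cauchyLikelihood_eq y n)
  rw [h']
  exact (by fun_prop : Continuous fun μ : ℝ =>
    Real.pi⁻¹ ^ n * Real.exp (-totalLoss y n μ)).measurable.ennreal_ofReal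

lemma totalLoss_neg_neg (y : ℕ → ℝ) (n : ℕ) (μ : ℝ) :
    totalLoss (fun i => -y i) n (-μ) = totalLoss y n μ := by
  simp [totalLoss, cauchyLoss_neg_neg]

lemma log_one_add_sq_le_totalLoss (y : ℕ → ℝ) (n : ℕ) (μ : ℝ) :
    n * (Real.log (1 + μ ^ 2) - Real.log 2) - totalLoss y n 0 ≤ totalLoss y n μ := by
  unfold totalLoss
  have : ∑ i ∈ Finset.range n, (Real.log (1 + μ ^ 2) - Real.log 2 - cauchyLoss (y i) 0) ≤
      ∑ i ∈ Finset.range n, cauchyLoss (y i) μ :=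
    Finset.sum_le_sum fun i _ => log_one_add_sq_le_cauchyLoss (y i) μ
  simpa [Finset.sum_sub_distrib, mul_sub] using this

/-- Two data sequences that agree up to finitely many terms have total losses at bounded
distance, uniformly in the parameter. -/
lemma exists_abs_totalLoss_sub_le {y z : ℕ → ℝ} {k : ℕ} (h : ∀ i, k ≤ i → y i = z i) :
    ∃ C : ℝ, ∀ n μ, |totalLoss y n μ - totalLoss z n μ| ≤ C := by
  -- The loss is also 1-Lipschitz in the observation, so only the first `k` terms contribute, each
  -- by an amount free of `μ`.
  refine ⟨∑ i ∈ Finset.range k, |y i - z i|, fun n μ => ?_⟩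
  unfold totalLoss
  rw [← Finset.sum_sub_distrib]
  refine (Finset.abs_sum_le_sum_abs _ _).trans ?_
  refine (Finset.sum_le_sum fun i _ => abs_cauchyLoss_sub_le' (y i) (z i) μ).trans ?_
  rw [← Finset.sum_filter_add_sum_filter_not (Finset.range n) (fun i => i < k)]
  rw [Finset.sum_eq_zero (s := (Finset.range n).filter fun i => ¬ i < k), add_zero]
  · refine Finset.sum_le_sum_of_subset_of_nonneg ?_ fun i _ _ => abs_nonneg _
    intro i; simp
  · intro i hi
    simp [h i (by simpa using (Finset.mem_filter.1 hi).2)]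

/-! ### Improper priors and the normalizing constant. -/

section Prior

variable (prior : Measure ℝ)

/-- Rewrites polynomial integrability of the prior in the form that matches lower bounds on the
total loss, using `1 + |μ| ≤ 2 (1 + μ²)`. -/
lemma exists_lintegral_one_add_sq_lt_top [h : prior.HasTemperateGrowth] :
    ∃ m : ℕ, ∫⁻ μ, ENNReal.ofReal (Real.exp (-(m * Real.log (1 + μ ^ 2)))) ∂prior < ⊤ := by
  obtain ⟨n, hn⟩ := h.exists_integrable
  refine ⟨n, ?_⟩
  have h2 := hn.const_mul ((2 : ℝ) ^ n)
  refine lt_of_le_of_lt (lintegral_mono fun μ => ENNReal.ofReal_le_ofReal ?_)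
    ((hasFiniteIntegral_iff_ofReal (ae_of_all _ fun μ => by positivity)).1 h2.2)
  rw [Real.exp_neg, Real.rpow_neg (by positivity), Real.rpow_natCast, ← Real.log_pow,
    Real.exp_log (by positivity), ← div_eq_mul_inv, inv_eq_one_div,
    div_le_div_iff₀ (by positivity) (by positivity), one_mul, ← mul_pow]
  apply pow_le_pow_left₀ (by positivity)
  rw [Real.norm_eq_abs]
  nlinarith [sq_abs μ, sq_nonneg (|μ| - 1)]

/-- The integrable weight is continuous and positive, so its superlevel sets are neighbourhoods of
finite mass. Local finiteness yields the s-finiteness behind measurability in the data. -/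
instance isLocallyFiniteMeasure_of_hasTemperateGrowth [h : prior.HasTemperateGrowth] :
    IsLocallyFiniteMeasure prior := by
  obtain ⟨n, hn⟩ := h.exists_integrable
  refine ⟨fun x => ?_⟩
  set f : ℝ → ℝ := fun x => (1 + ‖x‖) ^ (-(n : ℝ)) with hf
  have hc : Continuous f := by
    rw [hf]
    exact Continuous.rpow_const (by fun_prop) fun x => Or.inl (by positivity)
  have hx : 0 < f x := by rw [hf]; positivity
  refine ⟨{z | f x / 2 < f z}, (isOpen_lt continuous_const hc).mem_nhds (by simp [hx]), ?_⟩
  refine lt_of_le_of_lt (measure_mono fun z hz => ?_)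
    (hn.measure_norm_ge_lt_top (ε := f x / 2) (by positivity))
  exact (show f x / 2 < f z from hz).le.trans (le_abs_self _)

/-- The integral of the likelihood over a set of parameters. -/
noncomputable def likelihoodMass (y : ℕ → ℝ) (n : ℕ) (s : Set ℝ) : ENNReal :=
  ∫⁻ μ in s, cauchyLikelihood y n μ ∂prior

lemma cauchyPosterior_apply (y : ℕ → ℝ) (n : ℕ) {s : Set ℝ} (hs : MeasurableSet s) :
    cauchyPosterior prior y n s =
      (likelihoodMass prior y n Set.univ)⁻¹ * likelihoodMass prior y n s := by
  simp [cauchyPosterior, likelihoodMass, withDensity_apply _ hs]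

/-- A constant lower bound on the loss would be useless when the prior has infinite mass; the term
`m * log (1 + μ²)` is what gets integrated against it. -/
lemma likelihoodMass_le {y : ℕ → ℝ} {n m : ℕ} {D : ℝ} {s : Set ℝ} (hs : MeasurableSet s)
    (h : ∀ μ ∈ s, m * Real.log (1 + μ ^ 2) - D ≤ totalLoss y n μ) :
    likelihoodMass prior y n s ≤ ENNReal.ofReal (Real.pi⁻¹ ^ n * Real.exp D) *
      ∫⁻ μ, ENNReal.ofReal (Real.exp (-(m * Real.log (1 + μ ^ 2)))) ∂prior := by
  rw [likelihoodMass, ← lintegral_const_mul' _ _ ENNReal.ofReal_ne_top]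
  refine (setLIntegral_mono' hs fun μ hμ => ?_).trans (setLIntegral_le_lintegral _ _)
  rw [cauchyLikelihood_eq, ← ENNReal.ofReal_mul (by positivity), mul_assoc, ← Real.exp_add]
  apply ENNReal.ofReal_le_ofReal
  gcongr
  linarith [h μ hμ]

lemma le_likelihoodMass {y : ℕ → ℝ} {n : ℕ} {D : ℝ} {s : Set ℝ} (hs : MeasurableSet s)
    (h : ∀ μ ∈ s, totalLoss y n μ ≤ D) :
    ENNReal.ofReal (Real.pi⁻¹ ^ n * Real.exp (-D)) * prior s ≤ likelihoodMass prior y n s := by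
  rw [likelihoodMass, ← setLIntegral_const]
  refine setLIntegral_mono' hs fun μ hμ => ?_
  rw [cauchyLikelihood_eq]
  apply ENNReal.ofReal_le_ofReal
  gcongr
  exact h μ hμ

/-- Each observation contributes one factor of order `(1 + μ²)⁻¹`, so `m` observations suffice for
any data. -/
lemma likelihoodMass_lt_top {m : ℕ}
    (hm : ∫⁻ μ, ENNReal.ofReal (Real.exp (-(m * Real.log (1 + μ ^ 2)))) ∂prior < ⊤)
    (y : ℕ → ℝ) {n : ℕ} (hn : m ≤ n) : likelihoodMass prior y n Set.univ < ⊤ := by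
  refine (likelihoodMass_le prior (m := m) (D := n * Real.log 2 + totalLoss y n 0)
    MeasurableSet.univ fun μ _ => ?_).trans_lt (ENNReal.mul_lt_top ENNReal.ofReal_lt_top hm)
  have h1 := log_one_add_sq_le_totalLoss y n μ
  have h2 : (m : ℝ) * Real.log (1 + μ ^ 2) ≤ n * Real.log (1 + μ ^ 2) := by
    gcongr
    exact Real.log_nonneg (by nlinarith [sq_nonneg μ])
  linarith

lemma likelihoodMass_pos [prior.IsOpenPosMeasure] (y : ℕ → ℝ) (n : ℕ) :
    0 < likelihoodMass prior y n Set.univ := by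
  rw [likelihoodMass, setLIntegral_univ, lintegral_pos_iff_support (measurable_cauchyLikelihood y n)]
  have : Function.support (cauchyLikelihood y n) = Set.univ := by
    ext μ
    simp only [Function.mem_support, cauchyLikelihood_eq, Set.mem_univ, iff_true, ne_eq,
      ENNReal.ofReal_eq_zero, not_le]
    positivity
  rw [this]
  exact isOpen_univ.measure_pos _ Set.univ_nonempty

lemma cauchyPosterior_le_one (y : ℕ → ℝ) (n : ℕ) (s : Set ℝ) :
    cauchyPosterior prior y n s ≤ 1 := by
  refine (measure_mono (Set.subset_univ s)).trans ?_
  rw [cauchyPosterior_apply prior y n MeasurableSet.univ]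
  exact ENNReal.inv_mul_le_one _

lemma eventually_isProbabilityMeasure_cauchyPosterior [prior.IsOpenPosMeasure]
    [prior.HasTemperateGrowth] :
    ∃ m : ℕ, ∀ y n, m ≤ n → IsProbabilityMeasure (cauchyPosterior prior y n) := by
  obtain ⟨m, hm⟩ := exists_lintegral_one_add_sq_lt_top prior
  refine ⟨m, fun y n hn => ⟨?_⟩⟩
  rw [cauchyPosterior_apply prior y n MeasurableSet.univ]
  exact ENNReal.inv_mul_cancel (likelihoodMass_pos prior y n).ne'
    (likelihoodMass_lt_top prior hm y hn).ne

lemma measurable_likelihoodMass [SFinite prior] (n : ℕ) (s : Set ℝ) :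
    Measurable fun y => likelihoodMass prior y n s :=
  Measurable.lintegral_prod_right' (ν := prior.restrict s) (measurable_cauchyLikelihood_uncurry n)

lemma measurable_cauchyPosterior [SFinite prior] (n : ℕ) {s : Set ℝ} (hs : MeasurableSet s) :
    Measurable fun y => cauchyPosterior prior y n s := by
  simp only [cauchyPosterior_apply prior _ n hs]
  exact (measurable_likelihoodMass prior n _).inv.mul (measurable_likelihoodMass prior n _)

end Prior

/-! ### Posterior consistency for a fixed data sequence. -/

section Deterministic

variable {y : ℕ → ℝ} {g : ℝ → ℝ}

lemma abs_limit_sub_le (hg : ∀ μ, Tendsto (fun n : ℕ => totalLoss y n μ / n) atTop (𝓝 (g μ)))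
    (μ ν : ℝ) : |g μ - g ν| ≤ |μ - ν| := by
  refine le_of_tendsto ((hg μ).sub (hg ν)).abs ?_
  filter_upwards [eventually_gt_atTop 0] with n hn
  have hn' : (0 : ℝ) < n := Nat.cast_pos.2 hn
  rw [← sub_div, abs_div, abs_of_pos hn', div_le_iff₀ hn', mul_comm]
  exact abs_totalLoss_sub_le y n μ ν

lemma continuous_limit (hg : ∀ μ, Tendsto (fun n : ℕ => totalLoss y n μ / n) atTop (𝓝 (g μ))) :
    Continuous g :=
  (LipschitzWith.of_dist_le_mul (K := 1) fun μ ν => by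
    simpa [Real.dist_eq] using abs_limit_sub_le hg μ ν).continuous

lemma limit_nonneg (hg : ∀ μ, Tendsto (fun n : ℕ => totalLoss y n μ / n) atTop (𝓝 (g μ)))
    (μ : ℝ) : 0 ≤ g μ :=
  ge_of_tendsto' (hg μ) fun n =>
    div_nonneg (Finset.sum_nonneg fun _ _ => cauchyLoss_nonneg _ _) (Nat.cast_nonneg n)

lemma log_one_add_sq_le_limit
    (hg : ∀ μ, Tendsto (fun n : ℕ => totalLoss y n μ / n) atTop (𝓝 (g μ))) (μ : ℝ) :
    Real.log (1 + μ ^ 2) - Real.log 2 - g 0 ≤ g μ := by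
  refine le_of_tendsto_of_tendsto (tendsto_const_nhds.sub (hg 0)) (hg μ) ?_
  filter_upwards [eventually_gt_atTop 0] with n hn
  have hn' : (0 : ℝ) < n := Nat.cast_pos.2 hn
  rw [le_div_iff₀ hn', sub_mul, div_mul_cancel₀ _ hn'.ne', mul_comm]
  exact log_one_add_sq_le_totalLoss y n μ

lemma exists_log_one_add_sq_ge (C : ℝ) : ∃ K : ℝ, ∀ μ, K ≤ |μ| → C ≤ Real.log (1 + μ ^ 2) := by
  refine ⟨Real.exp (C / 2), fun μ hμ => ?_⟩
  rw [Real.le_log_iff_exp_le (by positivity)]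
  have : Real.exp C = Real.exp (C / 2) ^ 2 := by rw [← Real.exp_nat_mul]; congr 1; push_cast; ring
  rw [this, ← sq_abs μ]
  have := pow_le_pow_left₀ (Real.exp_pos (C / 2)).le hμ 2
  linarith

/-- A finite cover upgrades pointwise to uniform control: at each centre half of the gap absorbs the
convergence error and the other half the Lipschitz variation over the ball. -/
lemma eventually_le_totalLoss_of_isCompact
    (hg : ∀ μ, Tendsto (fun n : ℕ => totalLoss y n μ / n) atTop (𝓝 (g μ)))
    {K : Set ℝ} (hK : IsCompact K) {c : ℝ} (hc : ∀ μ ∈ K, c < g μ) :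
    ∀ᶠ n : ℕ in atTop, ∀ μ ∈ K, n * c ≤ totalLoss y n μ := by
  refine hK.induction_on (p := fun K => ∀ᶠ n : ℕ in atTop, ∀ μ ∈ K, n * c ≤ totalLoss y n μ)
    (by simp) (fun s t hst h => h.mono fun n hn μ hμ => hn μ (hst hμ))
    (fun s t hs ht => ?_) fun x hx => ?_
  · filter_upwards [hs, ht] with n h1 h2 μ hμ
    exact hμ.elim (h1 μ) (h2 μ)
  · set ε := (g x - c) / 2 with hε
    have hε0 : 0 < ε := by have := hc x hx; simp only [hε]; linarith
    refine ⟨Metric.ball x ε, mem_nhdsWithin_of_mem_nhds (Metric.ball_mem_nhds x hε0), ?_⟩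
    filter_upwards [(hg x).eventually_const_lt (show c + ε < g x by linarith),
      eventually_gt_atTop 0] with n h1 hn μ hμ
    have hn' : (0 : ℝ) < n := Nat.cast_pos.2 hn
    rw [lt_div_iff₀ hn'] at h1
    have h2 := (abs_le.1 (abs_totalLoss_sub_le y n μ x)).1
    have h3 : (n : ℝ) * |μ - x| ≤ n * ε := by
      gcongr
      exact (Metric.mem_ball.1 hμ).le
    nlinarith

/-- Compactness handles bounded `μ` and logarithmic growth handles the rest. The bound keeps `m`
copies of `log (1 + μ²)` in reserve for integrating the prior. -/
lemma exists_eventually_le_totalLoss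
    (hg : ∀ μ, Tendsto (fun n : ℕ => totalLoss y n μ / n) atTop (𝓝 (g μ)))
    {F : Set ℝ} (hF : IsClosed F) {c : ℝ} (h0 : 0 ≤ c) (hc : ∀ μ ∈ F, c < g μ) (m : ℕ) :
    ∃ D : ℝ, ∀ᶠ n : ℕ in atTop, ∀ μ ∈ F,
      m * Real.log (1 + μ ^ 2) - (D - n * c) ≤ totalLoss y n μ := by
  set C := Real.log 2 + g 0 + 1 with hC
  obtain ⟨K, hK⟩ := exists_log_one_add_sq_ge (C + c)
  have hcomp := eventually_le_totalLoss_of_isCompact hg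
    ((isCompact_Icc (a := -K) (b := K)).inter_left hF) fun μ hμ => hc μ hμ.1
  have hC0 : 0 ≤ C := by have := limit_nonneg hg 0; have := Real.log_pos one_lt_two; linarith
  have hL : 0 ≤ Real.log (1 + K ^ 2) := Real.log_nonneg (by nlinarith [sq_nonneg K])
  -- The first summand pays for the reserved term on `[-K, K]`; the second pays for the `m` copies
  -- withheld where `|μ| > K`.
  refine ⟨m * Real.log (1 + K ^ 2) + m * (C + c), ?_⟩
  filter_upwards [hcomp, (hg 0).eventually_lt_const (lt_add_one (g 0)), eventually_ge_atTop m,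
    eventually_gt_atTop 0] with n h1 h2 hn hn0 μ hμ
  have hn' : (0 : ℝ) < n := Nat.cast_pos.2 hn0
  have hm : (m : ℝ) ≤ n := Nat.cast_le.2 hn
  rcases le_or_gt |μ| K with hle | hgt
  · have h3 := h1 μ ⟨hμ, abs_le.1 hle⟩
    have h4 : Real.log (1 + μ ^ 2) ≤ Real.log (1 + K ^ 2) := by
      apply Real.log_le_log (by positivity)
      have := sq_le_sq' (by linarith [abs_nonneg μ, neg_abs_le μ]) ((le_abs_self μ).trans hle)
      linarith
    have h5 : (m : ℝ) * Real.log (1 + μ ^ 2) ≤ m * Real.log (1 + K ^ 2) := by gcongr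
    have h6 : 0 ≤ (m : ℝ) * (C + c) := by positivity
    linarith
  · have h3 := hK μ hgt.le
    have h4 := log_one_add_sq_le_totalLoss y n μ
    rw [div_lt_iff₀ hn'] at h2
    have h5 : 0 ≤ (m : ℝ) * Real.log (1 + K ^ 2) := by positivity
    nlinarith [mul_le_mul_of_nonneg_left h3 (sub_nonneg.2 hm)]

/-- The limit `g` is coercive and continuous, so strict inequality on a closed set gives a uniform
gap. -/
lemma exists_add_lt_of_forall_lt
    (hg : ∀ μ, Tendsto (fun n : ℕ => totalLoss y n μ / n) atTop (𝓝 (g μ)))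
    {F : Set ℝ} (hF : IsClosed F) {γ : ℝ} (hγ : ∀ μ ∈ F, g γ < g μ) :
    ∃ ε > 0, ∀ μ ∈ F, g γ + 2 * ε < g μ := by
  obtain ⟨K, hK⟩ := exists_log_one_add_sq_ge (Real.log 2 + g 0 + g γ + 3)
  have hout : ∀ μ, K ≤ |μ| → g γ + 2 * 1 < g μ := fun μ hμ => by
    have := hK μ hμ
    have := log_one_add_sq_le_limit hg μ
    linarith
  rcases (F ∩ Set.Icc (-K) K).eq_empty_or_nonempty with he | hne
  · refine ⟨1, one_pos, fun μ hμ => hout μ ?_⟩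
    by_contra! hlt
    exact (Set.eq_empty_iff_forall_notMem.1 he) μ ⟨hμ, abs_le.1 hlt.le⟩
  · obtain ⟨x, hx, hmin⟩ := (isCompact_Icc.inter_left hF).exists_isMinOn hne
      (continuous_limit hg).continuousOn
    have hx' := hγ x hx.1
    refine ⟨min 1 ((g x - g γ) / 4), lt_min one_pos (by linarith), fun μ hμ => ?_⟩
    rcases le_or_gt K |μ| with h | h
    · have := hout μ h
      have := min_le_left 1 ((g x - g γ) / 4)
      linarith
    · have : g x ≤ g μ := hmin ⟨hμ, abs_le.1 h.le⟩
      have := min_le_right 1 ((g x - g γ) / 4)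
      linarith

/-- Posterior consistency for a deterministic data sequence: if the average loss converges
pointwise, then the posterior mass of a closed set that stays away from the minimizers of the limit
tends to zero. -/
theorem tendsto_cauchyPosterior_zero (prior : Measure ℝ) [prior.IsOpenPosMeasure]
    [prior.HasTemperateGrowth]
    (hg : ∀ μ, Tendsto (fun n : ℕ => totalLoss y n μ / n) atTop (𝓝 (g μ)))
    {F : Set ℝ} (hF : IsClosed F) {γ : ℝ} (hγ : ∀ μ ∈ F, g γ < g μ) :
    Tendsto (fun n => cauchyPosterior prior y n F) atTop (𝓝 0) := by
  obtain ⟨m, hm⟩ := exists_lintegral_one_add_sq_lt_top prior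
  set I := ∫⁻ μ, ENNReal.ofReal (Real.exp (-(m * Real.log (1 + μ ^ 2)))) ∂prior with hI
  obtain ⟨ε, hε, hgap⟩ := exists_add_lt_of_forall_lt hg hF hγ
  have hγ0 := limit_nonneg hg γ
  obtain ⟨D, hD⟩ := exists_eventually_le_totalLoss hg hF (c := g γ + 2 * ε) (by positivity) hgap m
  -- Of the gap `2 * ε`, the normalizing constant uses up one `ε`: half for convergence at `γ`, half
  -- for the Lipschitz variation on this ball. The factor `exp (-ε) ^ n` remains.
  set b := prior (Metric.ball γ (ε / 2)) with hb
  have hb0 : b ≠ 0 := (Metric.isOpen_ball.measure_pos prior (by simp [hε])).ne'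
  have key : ∀ᶠ n : ℕ in atTop, cauchyPosterior prior y n F ≤
      ENNReal.ofReal (Real.exp D * Real.exp (-ε) ^ n) * (I * b⁻¹) := by
    filter_upwards [hD, (hg γ).eventually_lt_const (show g γ < g γ + ε / 2 by linarith),
      eventually_gt_atTop 0, eventually_ge_atTop m] with n h1 h2 hn hmn
    have hn' : (0 : ℝ) < n := Nat.cast_pos.2 hn
    rw [div_lt_iff₀ hn'] at h2
    have hnum := likelihoodMass_le prior hF.measurableSet h1
    have hden : ENNReal.ofReal (Real.pi⁻¹ ^ n * Real.exp (-(n * (g γ + ε)))) * b ≤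
        likelihoodMass prior y n Set.univ := by
      refine (le_likelihoodMass prior Metric.isOpen_ball.measurableSet fun μ hμ => ?_).trans
        (lintegral_mono_set (Set.subset_univ _))
      have h3 := (abs_le.1 (abs_totalLoss_sub_le y n μ γ)).2
      have h4 : (n : ℝ) * |μ - γ| ≤ n * (ε / 2) := by
        gcongr
        exact (Metric.mem_ball.1 hμ).le
      nlinarith
    rw [cauchyPosterior_apply prior y n hF.measurableSet]
    set Z := likelihoodMass prior y n Set.univ with hZ
    have hZ0 : Z ≠ 0 := (likelihoodMass_pos prior y n).ne'
    have hZt : Z ≠ ⊤ := (likelihoodMass_lt_top prior hm y hmn).ne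
    have hbt : b ≠ ⊤ := fun h => hZt (top_le_iff.1 (by
      refine le_trans (le_of_eq ?_) hden
      rw [h, ENNReal.mul_top]
      simp only [ne_eq, ENNReal.ofReal_eq_zero, not_le]
      positivity))
    rw [ENNReal.inv_mul_le_iff hZ0 hZt]
    refine hnum.trans ?_
    have hsplit : ENNReal.ofReal (Real.pi⁻¹ ^ n * Real.exp (D - n * (g γ + 2 * ε))) =
        ENNReal.ofReal (Real.pi⁻¹ ^ n * Real.exp (-(n * (g γ + ε)))) *
          ENNReal.ofReal (Real.exp D * Real.exp (-ε) ^ n) := by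
      rw [← ENNReal.ofReal_mul (by positivity), mul_assoc, ← Real.exp_nat_mul, ← Real.exp_add,
        ← Real.exp_add]
      congr 3
      ring
    rw [hsplit]
    calc _ = ENNReal.ofReal (Real.pi⁻¹ ^ n * Real.exp (-(n * (g γ + ε)))) * (b * b⁻¹) *
          ENNReal.ofReal (Real.exp D * Real.exp (-ε) ^ n) * I := by
            rw [ENNReal.mul_inv_cancel hb0 hbt, mul_one]
      _ = (ENNReal.ofReal (Real.pi⁻¹ ^ n * Real.exp (-(n * (g γ + ε)))) * b) *
          (ENNReal.ofReal (Real.exp D * Real.exp (-ε) ^ n) * (I * b⁻¹)) := by ring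
      _ ≤ _ := by gcongr
  refine tendsto_of_tendsto_of_tendsto_of_le_of_le' tendsto_const_nhds ?_
    (Eventually.of_forall fun _ => zero_le) key
  have hreal : Tendsto (fun n : ℕ => Real.exp D * Real.exp (-ε) ^ n) atTop (𝓝 0) := by
    simpa using (tendsto_pow_atTop_nhds_zero_of_lt_one (Real.exp_pos _).le
      (Real.exp_lt_one_iff.2 (neg_lt_zero.2 hε))).const_mul (Real.exp D)
  have := ENNReal.Tendsto.mul_const (b := I * b⁻¹) (ENNReal.tendsto_ofReal hreal)
    (Or.inr (ENNReal.mul_ne_top hm.ne (ENNReal.inv_ne_top.2 hb0)))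
  simpa using this

/-- If the limit of the average loss has a unique minimizer, then the posterior converges weakly to
the point mass there. -/
theorem tendsto_integral_cauchyPosterior (prior : Measure ℝ) [prior.IsOpenPosMeasure]
    [prior.HasTemperateGrowth]
    (hg : ∀ μ, Tendsto (fun n : ℕ => totalLoss y n μ / n) atTop (𝓝 (g μ)))
    {γ : ℝ} (hγ : ∀ μ, μ ≠ γ → g γ < g μ) (f : BoundedContinuousFunction ℝ ℝ) :
    Tendsto (fun n => ∫ μ, f μ ∂cauchyPosterior prior y n) atTop (𝓝 (f γ)) := by
  obtain ⟨m, hm⟩ := eventually_isProbabilityMeasure_cauchyPosterior prior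
  rw [Metric.tendsto_atTop']
  intro ε hε
  obtain ⟨δ, hδ, hfδ⟩ := Metric.continuousAt_iff.1 f.continuous.continuousAt (ε / 2) (half_pos hε)
  set F := (Metric.ball γ δ)ᶜ with hFdef
  have hF : IsClosed F := Metric.isOpen_ball.isClosed_compl
  have h0 := tendsto_cauchyPosterior_zero prior hg hF (γ := γ) fun μ hμ =>
    hγ μ fun h => hμ (by simp [h, hδ])
  have h1 : Tendsto (fun n => (cauchyPosterior prior y n).real F) atTop (𝓝 0) := by
    simpa [Measure.real, Function.comp_def] using (ENNReal.tendsto_toReal ENNReal.zero_ne_top).comp h0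
  -- Near `γ` continuity bounds the error by `ε / 2`; away from it the error is at most `2 * ‖f‖` on
  -- a set of vanishing mass.
  have h2 : Tendsto (fun n => ε / 2 + 2 * ‖f‖ * (cauchyPosterior prior y n).real F) atTop
      (𝓝 (ε / 2)) := by simpa using (h1.const_mul (2 * ‖f‖)).const_add (ε / 2)
  obtain ⟨N, hN⟩ := eventually_atTop.1
    ((h2.eventually_lt_const (half_lt_self hε)).and (eventually_ge_atTop m))
  refine ⟨N, fun n hn => ?_⟩
  obtain ⟨h3, hmn⟩ := hN n hn.le
  have := hm y n hmn
  refine lt_of_le_of_lt ?_ h3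
  set Q := cauchyPosterior prior y n
  have hint : Integrable f Q := f.integrable Q
  rw [Real.dist_eq]
  have e1 : ∫ μ, f μ ∂Q - f γ = ∫ μ, (f μ - f γ) ∂Q := by
    rw [integral_sub hint (integrable_const _)]; simp
  have hind : Integrable (F.indicator fun _ => 2 * ‖f‖) Q :=
    (integrable_const _).indicator hF.measurableSet
  calc |∫ μ, f μ ∂Q - f γ| ≤ ∫ μ, |f μ - f γ| ∂Q := by
        rw [e1]; exact abs_integral_le_integral_abs
    _ ≤ ∫ μ, (ε / 2 + F.indicator (fun _ => 2 * ‖f‖) μ) ∂Q := by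
        refine integral_mono (hint.sub (integrable_const _)).abs
          ((integrable_const _).add hind) fun μ => ?_
        by_cases hμ : μ ∈ F
        · simp only [Set.indicator_of_mem hμ]
          have a1 := f.norm_coe_le_norm μ
          have a2 := f.norm_coe_le_norm γ
          have a3 := abs_sub (f μ) (f γ)
          simp only [Real.norm_eq_abs] at a1 a2
          linarith
        · simp only [Set.indicator_of_notMem hμ, add_zero]
          have hμ' : dist μ γ < δ := by simpa [hFdef] using hμ
          exact (hfδ hμ').le
    _ = ε / 2 + 2 * ‖f‖ * Q.real F := by
        rw [integral_add (integrable_const _) hind, integral_indicator_const _ hF.measurableSet]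
        simp [mul_comm]

end Deterministic

/-! ### Closed form of the expected loss under one Cauchy law. -/

/-- The expected loss `E log (1 + (y - μ) ^ 2)` under `Cauchy(b, 1)`. -/
noncomputable def cauchyExpectedLoss (b μ : ℝ) : ℝ := ∫ y, cauchyLoss y μ ∂cauchyMeasure b 1

lemma cauchyMeasure_one (b : ℝ) :
    cauchyMeasure b 1 = volume.withDensity (cauchyPDF b 1) :=
  cauchyMeasure_of_scale_ne_zero b one_ne_zero

lemma cauchyPDFReal_one (b y : ℝ) : cauchyPDFReal b 1 y = Real.pi⁻¹ * (1 + (y - b) ^ 2)⁻¹ := by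
  simp [cauchyPDFReal, add_comm]

lemma integral_cauchyMeasure (b : ℝ) (f : ℝ → ℝ) :
    ∫ y, f y ∂cauchyMeasure b 1 = ∫ y, Real.pi⁻¹ * ((1 + (y - b) ^ 2)⁻¹ * f y) := by
  rw [cauchyMeasure_one, integral_withDensity_eq_integral_toReal_smul (measurable_cauchyPDF b 1)
    (ae_of_all _ fun y => ENNReal.ofReal_lt_top)]
  congr 1 with y
  rw [cauchyPDF, ENNReal.toReal_ofReal (cauchyPDF_pos b one_ne_zero y).le, cauchyPDFReal_one,
    smul_eq_mul, mul_assoc]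

lemma measurable_cauchyLoss (μ : ℝ) : Measurable fun y => cauchyLoss y μ :=
  (continuous_cauchyLoss.comp (by fun_prop : Continuous fun y : ℝ => (y, μ))).measurable

/-- The logarithm is at most `4 (1 + y²)^(1/4)`, which leaves the integrable power `(1 +
y²)^(-3/4)`. -/
lemma integrable_inv_mul_log_one_add_sq :
    Integrable fun y : ℝ => (1 + y ^ 2)⁻¹ * Real.log (1 + y ^ 2) := by
  have h := (integrable_rpow_neg_one_add_norm_sq (E := ℝ) (μ := volume) (r := 3 / 2)
    (by norm_num)).const_mul 4
  refine h.mono' ?_ (ae_of_all _ fun y => ?_)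
  · exact (by fun_prop : Measurable fun y : ℝ => (1 + y ^ 2)⁻¹ * Real.log (1 + y ^ 2)).aestronglyMeasurable
  · have hpos : 0 < 1 + y ^ 2 := by positivity
    have hlog := Real.log_le_rpow_div hpos.le (show (0 : ℝ) < 1 / 4 by norm_num)
    have h0 : 0 ≤ Real.log (1 + y ^ 2) := Real.log_nonneg (by nlinarith [sq_nonneg y])
    rw [Real.norm_of_nonneg (by positivity), Real.norm_eq_abs, sq_abs]
    calc (1 + y ^ 2)⁻¹ * Real.log (1 + y ^ 2)
        ≤ (1 + y ^ 2)⁻¹ * ((1 + y ^ 2) ^ (1 / 4 : ℝ) / (1 / 4)) := by gcongr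
      _ = 4 * ((1 + y ^ 2) ^ (-1 : ℝ) * (1 + y ^ 2) ^ (1 / 4 : ℝ)) := by
          rw [Real.rpow_neg_one]; ring
      _ = 4 * (1 + y ^ 2) ^ (-(3 / 2) / 2 : ℝ) := by
          rw [← Real.rpow_add hpos]; norm_num

/-- For `μ = b` this is a translate of the standard integral; changing `μ` alters the loss by a
bounded amount. -/
lemma integrable_cauchyLoss_cauchyMeasure (b μ : ℝ) :
    Integrable (fun y => cauchyLoss y μ) (cauchyMeasure b 1) := by
  have hb : Integrable (fun y => cauchyLoss y b) (cauchyMeasure b 1) := by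
    rw [cauchyMeasure_one, integrable_withDensity_iff (measurable_cauchyPDF b 1)
      (ae_of_all _ fun y => ENNReal.ofReal_lt_top)]
    have h := (integrable_inv_mul_log_one_add_sq.comp_sub_right b).const_mul Real.pi⁻¹
    refine h.congr (ae_of_all _ fun y => ?_)
    simp only
    rw [cauchyPDF, ENNReal.toReal_ofReal (cauchyPDF_pos b one_ne_zero y).le, cauchyPDFReal_one,
      cauchyLoss]
    ring
  refine (hb.add (integrable_const |μ - b|)).mono'
    (measurable_cauchyLoss μ).aestronglyMeasurable (ae_of_all _ fun y => ?_)
  rw [Real.norm_of_nonneg (cauchyLoss_nonneg y μ)]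
  have := (abs_le.1 (abs_cauchyLoss_sub_le y μ b)).2
  simp only [Pi.add_apply]
  linarith

lemma hasDerivAt_cauchyLoss (y μ : ℝ) :
    HasDerivAt (cauchyLoss y) (2 * (μ - y) / (1 + (μ - y) ^ 2)) μ := by
  have h := (hasDerivAt_log_one_add_sq (μ - y)).comp μ ((hasDerivAt_id μ).sub_const y)
  rw [mul_one] at h
  refine h.congr_of_eventuallyEq (Eventually.of_forall fun ν => ?_)
  simp only [cauchyLoss, Function.comp, id]
  congr 2; ring

lemma hasDerivAt_cauchyExpectedLoss (b μ : ℝ) :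
    HasDerivAt (cauchyExpectedLoss b)
      (∫ y, 2 * (μ - y) / (1 + (μ - y) ^ 2) ∂cauchyMeasure b 1) μ := by
  refine (hasDerivAt_integral_of_dominated_loc_of_deriv_le (F := fun ν y => cauchyLoss y ν)
    (F' := fun ν y => 2 * (ν - y) / (1 + (ν - y) ^ 2)) (bound := fun _ => 1) (s := Set.univ)
    univ_mem (Eventually.of_forall fun ν => (measurable_cauchyLoss ν).aestronglyMeasurable)
    (integrable_cauchyLoss_cauchyMeasure b μ) ?_ ?_ (integrable_const _) ?_).2
  · exact (by fun_prop : Measurable fun y : ℝ =>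
      2 * (μ - y) / (1 + (μ - y) ^ 2)).aestronglyMeasurable
  · exact ae_of_all _ fun y ν _ => abs_two_mul_div_one_add_sq_le (ν - y)
  · exact ae_of_all _ fun y ν _ => hasDerivAt_cauchyLoss y ν

lemma tendsto_log_one_add_sq_sub_atTop (d : ℝ) :
    Tendsto (fun u : ℝ => Real.log (1 + (u - d) ^ 2) - Real.log (1 + u ^ 2)) atTop (𝓝 0) := by
  have h1 : Tendsto (fun u : ℝ => (1 + d ^ 2 * (u⁻¹ * u⁻¹) - 2 * d * u⁻¹ + u⁻¹ * u⁻¹) /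
      (1 + u⁻¹ * u⁻¹)) atTop (𝓝 1) := by
    have h := tendsto_inv_atTop_zero (𝕜 := ℝ)
    have := (((((h.mul h).const_mul (d ^ 2)).const_add 1).sub (h.const_mul (2 * d))).add
      (h.mul h)).div ((h.mul h).const_add 1) (by norm_num)
    simpa [Pi.div_def] using this
  have h2 := (Real.continuousAt_log one_ne_zero).tendsto.comp h1
  rw [Real.log_one] at h2
  refine h2.congr' ?_
  filter_upwards [eventually_gt_atTop 0] with u hu
  rw [← Real.log_div (by positivity) (by positivity)]
  simp only [Function.comp]
  congr 1
  field_simp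
  ring

lemma tendsto_log_one_add_sq_sub_atBot (d : ℝ) :
    Tendsto (fun u : ℝ => Real.log (1 + (u - d) ^ 2) - Real.log (1 + u ^ 2)) atBot (𝓝 0) := by
  refine ((tendsto_log_one_add_sq_sub_atTop (-d)).comp tendsto_neg_atBot_atTop).congr fun u => ?_
  simp only [Function.comp]
  congr 3 <;> ring

lemma integrable_inv_one_add_sq_mul (d : ℝ) :
    Integrable fun u : ℝ => (1 + u ^ 2)⁻¹ * (2 * (d - u) / (1 + (d - u) ^ 2)) := by
  refine integrable_inv_one_add_sq.mono' ?_ (ae_of_all _ fun u => ?_)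
  · exact (by fun_prop : Measurable fun u : ℝ =>
      (1 + u ^ 2)⁻¹ * (2 * (d - u) / (1 + (d - u) ^ 2))).aestronglyMeasurable
  · rw [norm_mul, Real.norm_of_nonneg (by positivity)]
    exact mul_le_of_le_one_right (by positivity) (abs_two_mul_div_one_add_sq_le _)

/-- Partial fractions give an explicit antiderivative. Its logarithmic part vanishes at both ends,
and the arctangents contribute `π * (β + δ)`. -/
lemma integral_inv_one_add_sq_mul (d : ℝ) :
    ∫ u : ℝ, (1 + u ^ 2)⁻¹ * (2 * (d - u) / (1 + (d - u) ^ 2)) =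
      Real.pi * (2 * d / (d ^ 2 + 4)) := by
  have hint := integrable_inv_one_add_sq_mul d
  rcases eq_or_ne d 0 with rfl | hd
  -- The coefficients below have a pole at `d = 0`; there the integrand is the derivative of `(1 +
  -- u²)⁻¹`.
  · have hinv : ∀ l : Filter ℝ, Tendsto (fun u : ℝ => u ^ 2) l atTop →
        Tendsto (fun u : ℝ => (1 + u ^ 2)⁻¹) l (𝓝 0) := fun l hl =>
      tendsto_inv_atTop_zero.comp (tendsto_atTop_add_const_left _ _ hl)
    rw [integral_of_hasDerivAt_of_tendsto (f := fun u : ℝ => (1 + u ^ 2)⁻¹) (m := 0) (n := 0)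
      (fun u => ?_) hint (hinv _ (((tendsto_pow_atTop two_ne_zero).comp tendsto_neg_atBot_atTop).congr fun u => neg_sq u))
      (hinv _ (tendsto_pow_atTop two_ne_zero))]
    · simp
    · have h := (((hasDerivAt_id u).pow 2).const_add 1).inv
        (by simp only [id, Pi.pow_apply]; positivity)
      simp only [id, Pi.pow_apply] at h
      convert! h using 1
      simp
      field_simp
  · set α : ℝ := -2 / (d ^ 2 + 4) with hα
    set β : ℝ := -4 / (d * (d ^ 2 + 4)) with hβ
    set δ : ℝ := (2 * d ^ 2 + 4) / (d * (d ^ 2 + 4)) with hδ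
    have hderiv : ∀ u : ℝ, HasDerivAt (fun u : ℝ => α / 2 *
        (Real.log (1 + (u - d) ^ 2) - Real.log (1 + u ^ 2)) +
        (β * Real.arctan (u - d) + δ * Real.arctan u))
        ((1 + u ^ 2)⁻¹ * (2 * (d - u) / (1 + (d - u) ^ 2))) u := by
      intro u
      have h1 := (hasDerivAt_log_one_add_sq (u - d)).comp u ((hasDerivAt_id u).sub_const d)
      have h2 := hasDerivAt_log_one_add_sq u
      have h3 := (Real.hasDerivAt_arctan (u - d)).comp u ((hasDerivAt_id u).sub_const d)
      have h4 := Real.hasDerivAt_arctan u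
      have h := ((h1.sub h2).const_mul (α / 2)).add ((h3.const_mul β).add (h4.const_mul δ))
      convert! h using 1
      have e1 : 1 + (d - u) ^ 2 = 1 + (u - d) ^ 2 := by ring
      have e2 : 1 + (u - d) ^ 2 ≠ 0 := by positivity
      rw [e1, hα, hβ, hδ]
      field_simp
      ring
    have hlim := integral_of_hasDerivAt_of_tendsto hderiv hint
      (((tendsto_log_one_add_sq_sub_atBot d).const_mul (α / 2)).add
        ((((tendsto_nhds_of_tendsto_nhdsWithin Real.tendsto_arctan_atBot).comp
          (tendsto_atBot_add_const_right atBot (-d) tendsto_id)).const_mul β).add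
          ((tendsto_nhds_of_tendsto_nhdsWithin Real.tendsto_arctan_atBot).const_mul δ)))
      (((tendsto_log_one_add_sq_sub_atTop d).const_mul (α / 2)).add
        ((((tendsto_nhds_of_tendsto_nhdsWithin Real.tendsto_arctan_atTop).comp
          (tendsto_atTop_add_const_right atTop (-d) tendsto_id)).const_mul β).add
          ((tendsto_nhds_of_tendsto_nhdsWithin Real.tendsto_arctan_atTop).const_mul δ)))
    rw [hlim, hβ, hδ]
    field_simp
    ring

lemma integral_two_mul_sub_div_cauchyMeasure (b μ : ℝ) :
    ∫ y, 2 * (μ - y) / (1 + (μ - y) ^ 2) ∂cauchyMeasure b 1 =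
      2 * (μ - b) / ((μ - b) ^ 2 + 4) := by
  rw [integral_cauchyMeasure, integral_const_mul, ← integral_sub_right_eq_self _ (-b)]
  have := integral_inv_one_add_sq_mul (μ - b)
  have e : ∀ y : ℝ, (1 + (y - -b - b) ^ 2)⁻¹ * (2 * (μ - (y - -b)) / (1 + (μ - (y - -b)) ^ 2)) =
      (1 + y ^ 2)⁻¹ * (2 * (μ - b - y) / (1 + (μ - b - y) ^ 2)) := fun y => by
    congr 2 <;> ring
  simp only [e, this]
  field_simp

lemma cauchyExpectedLoss_self (b : ℝ) : cauchyExpectedLoss b b = cauchyExpectedLoss 0 0 := by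
  unfold cauchyExpectedLoss cauchyLoss
  rw [integral_cauchyMeasure, integral_cauchyMeasure]
  simpa using integral_sub_right_eq_self
    (fun y : ℝ => Real.pi⁻¹ * ((1 + y ^ 2)⁻¹ * Real.log (1 + y ^ 2))) b

/-- Both sides have the same derivative in `μ` and agree at `μ = b`. The additive constant is left
unevaluated, since it does not affect minimizers. -/
lemma cauchyExpectedLoss_eq (b μ : ℝ) :
    cauchyExpectedLoss b μ =
      cauchyExpectedLoss 0 0 - Real.log 4 + Real.log ((μ - b) ^ 2 + 4) := by
  have hderiv : ∀ ν, HasDerivAt (fun ν => cauchyExpectedLoss b ν - Real.log ((ν - b) ^ 2 + 4))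
      0 ν := fun ν => by
    have h1 := hasDerivAt_cauchyExpectedLoss b ν
    rw [integral_two_mul_sub_div_cauchyMeasure] at h1
    have h2 := ((((hasDerivAt_id ν).sub_const b).pow 2).add_const 4).log
      (by simp only [id, Pi.pow_apply]; positivity)
    have h3 := h1.sub h2
    simp at h3
    exact h3
  have := is_const_of_deriv_eq_zero (fun ν => (hderiv ν).differentiableAt)
    (fun ν => (hderiv ν).deriv) μ b
  simp only [sub_self, cauchyExpectedLoss_self] at this
  norm_num at this
  linarith

/-! ### The expected loss of the mixture and its minimizers. -/

lemma isProbabilityMeasure_cauchyMixture (a : ℝ) {p : ℝ} (h0 : 0 ≤ p) (h1 : p ≤ 1) :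
    IsProbabilityMeasure (cauchyMixture a p) := ⟨by
  simp [cauchyMixture, ← ENNReal.ofReal_add h0 (sub_nonneg.2 h1)]⟩

lemma integrable_cauchyLoss_cauchyMixture (a p μ : ℝ) :
    Integrable (fun y => cauchyLoss y μ) (cauchyMixture a p) :=
  ((integrable_cauchyLoss_cauchyMeasure a μ).smul_measure ENNReal.ofReal_ne_top).add_measure
    ((integrable_cauchyLoss_cauchyMeasure (-a) μ).smul_measure ENNReal.ofReal_ne_top)

/-- The expected loss `E log (1 + (y - μ) ^ 2)` under the mixture. -/
noncomputable def mixtureExpectedLoss (a p μ : ℝ) : ℝ := ∫ y, cauchyLoss y μ ∂cauchyMixture a p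

lemma mixtureExpectedLoss_eq (a μ : ℝ) {p : ℝ} (h0 : 0 ≤ p) (h1 : p ≤ 1) :
    mixtureExpectedLoss a p μ = cauchyExpectedLoss 0 0 - Real.log 4 +
      (p * Real.log ((μ - a) ^ 2 + 4) + (1 - p) * Real.log ((μ + a) ^ 2 + 4)) := by
  rw [mixtureExpectedLoss, cauchyMixture, integral_add_measure
    ((integrable_cauchyLoss_cauchyMeasure a μ).smul_measure ENNReal.ofReal_ne_top)
    ((integrable_cauchyLoss_cauchyMeasure (-a) μ).smul_measure ENNReal.ofReal_ne_top),
    integral_smul_measure, integral_smul_measure, ENNReal.toReal_ofReal h0,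
    ENNReal.toReal_ofReal (sub_nonneg.2 h1)]
  have e1 := cauchyExpectedLoss_eq a μ
  have e2 := cauchyExpectedLoss_eq (-a) μ
  rw [cauchyExpectedLoss] at e1 e2
  rw [e1, e2, sub_neg_eq_add, smul_eq_mul, smul_eq_mul]
  ring

lemma expectedLogDensity_eq (a μ : ℝ) {p : ℝ} (h0 : 0 ≤ p) (h1 : p ≤ 1) :
    expectedLogDensity a p μ = -Real.log Real.pi - mixtureExpectedLoss a p μ := by
  have := isProbabilityMeasure_cauchyMixture a h0 h1
  simp only [expectedLogDensity, log_cauchyPDFReal, mixtureExpectedLoss]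
  rw [integral_sub (integrable_const _) (integrable_cauchyLoss_cauchyMixture a p μ)]
  simp

/-- With equal weights, the expected loss is minimal exactly at the two points `± √(a ^ 2 - 4)`. -/
lemma mixtureExpectedLoss_half_lt {a γ μ : ℝ} (hγ : γ ^ 2 = a ^ 2 - 4)
    (h1 : μ ≠ γ) (h2 : μ ≠ -γ) :
    mixtureExpectedLoss a (1 / 2) γ < mixtureExpectedLoss a (1 / 2) μ := by
  rw [mixtureExpectedLoss_eq a γ (by norm_num) (by norm_num),
    mixtureExpectedLoss_eq a μ (by norm_num) (by norm_num)]
  have h : Real.log (((γ - a) ^ 2 + 4) * ((γ + a) ^ 2 + 4)) <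
      Real.log (((μ - a) ^ 2 + 4) * ((μ + a) ^ 2 + 4)) := by
    apply Real.log_lt_log (by positivity)
    have h3 : μ ^ 2 - γ ^ 2 ≠ 0 := by
      rw [sq_sub_sq]
      exact mul_ne_zero (fun h => h2 (by linarith)) (sub_ne_zero.2 h1)
    have h4 : 0 < (μ ^ 2 - γ ^ 2) ^ 2 := by positivity
    have ea : a ^ 2 = γ ^ 2 + 4 := by linarith
    -- Completing the square in `x²` shows that the product is smallest exactly when `x² = a² - 4`.
    have e : ∀ x : ℝ, ((x - a) ^ 2 + 4) * ((x + a) ^ 2 + 4) =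
        (x ^ 2 - (a ^ 2 - 4)) ^ 2 + 16 * a ^ 2 := fun x => by ring
    rw [e, e, ← hγ, sub_self]
    linarith
  rw [Real.log_mul (by positivity) (by positivity),
    Real.log_mul (by positivity) (by positivity)] at h
  linarith

/-- The derivative has the sign of a cubic with a single root on the nonnegative half-line, so the
loss falls and then rises there. A negative `μ` is strictly worse than `-μ` because the component at
`a` has more weight. -/
lemma exists_mixtureExpectedLoss_lt {a p : ℝ} (ha : 2 < a) (hp : 1 / 2 < p) (hp1 : p ≤ 1) :
    ∃ γ, ∀ μ, μ ≠ γ → mixtureExpectedLoss a p γ < mixtureExpectedLoss a p μ := by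
  set δ := 2 * p - 1 with hδ
  have hδ0 : 0 < δ := by linarith
  have ha0 : 0 < a := by linarith
  set c := δ * a ^ 3 + 4 * δ * a with hc
  have hc0 : 0 < c := by positivity
  -- Half the numerator of the derivative of `G` below, over the product of the two quadratics.
  set N : ℝ → ℝ := fun x => x ^ 3 + δ * a * x ^ 2 + (4 - a ^ 2) * x - c with hN
  obtain ⟨γ, hγmem, hγN⟩ : ∃ γ ∈ Set.Icc 0 (a + c), N γ = 0 := by
    have hcont : ContinuousOn N (Set.Icc 0 (a + c)) := by rw [hN]; fun_prop
    refine intermediate_value_Icc (by positivity) hcont ⟨?_, ?_⟩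
    · simp [hN, hc0.le]
    · have e : N (a + c) = (a + c) * (2 * a * c + c ^ 2 + δ * a * (a + c)) + 4 * (a + c) - c := by
        simp only [hN]; ring
      rw [e]
      have : 0 ≤ (a + c) * (2 * a * c + c ^ 2 + δ * a * (a + c)) := by positivity
      linarith
  have hγ0 : 0 < γ := lt_of_le_of_ne hγmem.1 fun h => by
    rw [← h] at hγN
    simp [hN] at hγN
    exact hc0.ne' hγN
  -- Subtracting `x * N γ = 0` cancels the linear term, whose sign would be unfavourable; the
  -- remaining cofactor is visibly positive for `x ≥ 0`.
  have hNfac : ∀ x, γ * N x = (x - γ) * (γ * x * (x + γ + δ * a) + c) := fun x => by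
    have : γ * N x = γ * N x - x * N γ := by rw [hγN]; ring
    rw [this]
    simp only [hN]
    ring
  set G : ℝ → ℝ := fun x =>
    p * Real.log ((x - a) ^ 2 + 4) + (1 - p) * Real.log ((x + a) ^ 2 + 4) with hG
  have hderiv : ∀ x, HasDerivAt G (2 * N x / (((x - a) ^ 2 + 4) * ((x + a) ^ 2 + 4))) x := by
    intro x
    have h1 := ((((hasDerivAt_id x).sub_const a).pow 2).add_const 4).log
      (by simp only [id, Pi.pow_apply]; positivity)
    have h2 := ((((hasDerivAt_id x).add_const a).pow 2).add_const 4).log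
      (by simp only [id, Pi.pow_apply]; positivity)
    convert! (h1.const_mul p).add (h2.const_mul (1 - p)) using 1
    simp only [hN, hc, hδ, id, Pi.pow_apply]
    norm_num
    field_simp
    ring
  have hcont : Continuous G := continuous_iff_continuousAt.2 fun x => (hderiv x).continuousAt
  have hanti : StrictAntiOn G (Set.Icc 0 γ) := by
    refine strictAntiOn_of_deriv_neg (convex_Icc _ _) hcont.continuousOn fun x hx => ?_
    rw [interior_Icc] at hx
    rw [(hderiv x).deriv]
    refine div_neg_of_neg_of_pos ?_ (by positivity)
    have h1 : 0 < γ * x * (x + γ + δ * a) + c := by have := hx.1; positivity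
    have h2 := hNfac x
    have h3 : (x - γ) * (γ * x * (x + γ + δ * a) + c) < 0 :=
      mul_neg_of_neg_of_pos (by linarith [hx.2]) h1
    rw [← h2] at h3
    nlinarith [neg_of_mul_neg_right h3 hγ0.le]
  have hmono : StrictMonoOn G (Set.Ici γ) := by
    refine strictMonoOn_of_deriv_pos (convex_Ici _) hcont.continuousOn fun x hx => ?_
    rw [interior_Ici] at hx
    have hx0 : 0 < x := hγ0.trans hx
    rw [(hderiv x).deriv]
    refine div_pos ?_ (by positivity)
    have h2 := hNfac x
    have h3 : 0 < (x - γ) * (γ * x * (x + γ + δ * a) + c) :=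
      mul_pos (sub_pos.2 hx) (by positivity)
    rw [← h2] at h3
    have := pos_of_mul_pos_right h3 hγ0.le
    linarith
  have hpos : ∀ x, 0 ≤ x → x ≠ γ → G γ < G x := fun x hx hne => by
    rcases lt_or_gt_of_ne hne with h | h
    · exact hanti ⟨hx, h.le⟩ ⟨hγ0.le, le_rfl⟩ h
    · exact hmono (Set.mem_Ici.2 le_rfl) h.le h
  have hrefl : ∀ x, x < 0 → G (-x) < G x := fun x hx => by
    have h : Real.log ((x + a) ^ 2 + 4) < Real.log ((x - a) ^ 2 + 4) := by
      apply Real.log_lt_log (by positivity)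
      nlinarith
    have e1 : (-x - a) ^ 2 = (x + a) ^ 2 := by ring
    have e2 : (-x + a) ^ 2 = (x - a) ^ 2 := by ring
    simp only [hG, e1, e2]
    nlinarith
  refine ⟨γ, fun μ hμ => ?_⟩
  rw [mixtureExpectedLoss_eq a γ (by linarith) hp1, mixtureExpectedLoss_eq a μ (by linarith) hp1]
  suffices G γ < G μ by simpa [hG] using this
  rcases le_or_gt 0 μ with h | h
  · exact hpos μ h hμ
  · refine lt_of_le_of_lt ?_ (hrefl μ h)
    rcases eq_or_ne (-μ) γ with h' | h'
    · rw [h']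
    · exact (hpos (-μ) (by linarith) h').le

/-! ### Limit theorems for i.i.d. sequences. -/

lemma tendsto_of_forall_rat {y : ℕ → ℝ} {g : ℝ → ℝ} (hg : ∀ μ ν, |g μ - g ν| ≤ |μ - ν|)
    (h : ∀ q : ℚ, Tendsto (fun n : ℕ => totalLoss y n q / n) atTop (𝓝 (g q))) (μ : ℝ) :
    Tendsto (fun n : ℕ => totalLoss y n μ / n) atTop (𝓝 (g μ)) := by
  rw [Metric.tendsto_atTop']
  intro ε hε
  obtain ⟨q, hq1, hq2⟩ := exists_rat_btwn (show μ < μ + ε / 3 by linarith)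
  have hq : |μ - q| ≤ ε / 3 := by rw [abs_le]; constructor <;> linarith
  obtain ⟨N, hN⟩ := (Metric.tendsto_atTop'.1 (h q)) (ε / 3) (by linarith)
  refine ⟨N, fun n hn => ?_⟩
  have hn' : (0 : ℝ) < n := Nat.cast_pos.2 (by omega)
  have h1 := hN n hn
  have h2 : |totalLoss y n μ / n - totalLoss y n q / n| ≤ |μ - q| := by
    rw [← sub_div, abs_div, abs_of_pos hn', div_le_iff₀ hn', mul_comm]
    exact abs_totalLoss_sub_le y n μ q
  have h3 := hg μ q
  rw [Real.dist_eq, abs_lt] at *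
  rw [abs_le] at h2 h3 hq
  constructor <;> linarith [h2.1, h2.2, h3.1, h3.2, h1.1, h1.2, le_abs_self (μ - (q : ℝ)),
    neg_abs_le (μ - (q : ℝ)), abs_le.2 hq]

section Sequence

variable (ν : Measure ℝ) [IsProbabilityMeasure ν]

/-- The law of a sequence of i.i.d. draws from `ν`. -/
noncomputable abbrev seqLaw : Measure (ℕ → ℝ) := Measure.infinitePi fun _ : ℕ => ν

lemma iIndepFun_seqLaw {f : ℝ → ℝ} (hf : Measurable f) :
    iIndepFun (fun (i : ℕ) (y : ℕ → ℝ) => f (y i)) (seqLaw ν) :=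
  iIndepFun_infinitePi (P := fun _ : ℕ => ν) (X := fun _ => f) fun _ => hf

lemma map_eval_seqLaw (i : ℕ) : (seqLaw ν).map (fun y => y i) = ν :=
  Measure.infinitePi_map_eval (fun _ : ℕ => ν) i

lemma identDistrib_seqLaw {f : ℝ → ℝ} (hf : Measurable f) (i : ℕ) :
    IdentDistrib (fun y : ℕ → ℝ => f (y i)) (fun y => f (y 0)) (seqLaw ν) (seqLaw ν) :=
  IdentDistrib.comp (f := fun y : ℕ → ℝ => y i) (g := fun y : ℕ → ℝ => y 0)
    ⟨(measurable_pi_apply i).aemeasurable, (measurable_pi_apply 0).aemeasurable, by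
      rw [map_eval_seqLaw, map_eval_seqLaw]⟩ hf

lemma integral_eval_seqLaw {f : ℝ → ℝ} (hf : Measurable f) (i : ℕ) :
    ∫ y, f (y i) ∂seqLaw ν = ∫ x, f x ∂ν := by
  conv_rhs => rw [← map_eval_seqLaw ν i]
  rw [integral_map (measurable_pi_apply i).aemeasurable hf.aestronglyMeasurable]

/-- The strong law at rational parameters costs countably many null sets; the common Lipschitz
constant extends the convergence to all real `μ` simultaneously. -/
lemma ae_tendsto_totalLoss_div (hν : ∀ μ, Integrable (fun y => cauchyLoss y μ) ν) :
    ∀ᵐ y ∂seqLaw ν, ∀ μ, Tendsto (fun n : ℕ => totalLoss y n μ / n) atTop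
      (𝓝 (∫ x, cauchyLoss x μ ∂ν)) := by
  have hrat : ∀ q : ℚ, ∀ᵐ y ∂seqLaw ν, Tendsto (fun n : ℕ => totalLoss y n q / n) atTop
      (𝓝 (∫ x, cauchyLoss x q ∂ν)) := fun q => by
    have hm := measurable_cauchyLoss (q : ℝ)
    have h := strong_law_ae_real (μ := seqLaw ν) (fun i y => cauchyLoss (y i) q) ?_
      (fun i j hij => (iIndepFun_seqLaw ν hm).indepFun hij) (identDistrib_seqLaw ν hm)
    · simpa [integral_eval_seqLaw ν hm, totalLoss] using h
    · refine Integrable.comp_measurable (g := fun x => cauchyLoss x q)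
        (f := fun y : ℕ → ℝ => y 0) ?_ (by fun_prop)
      rw [map_eval_seqLaw]
      exact hν q
  filter_upwards [ae_all_iff.2 hrat] with y hy
  refine tendsto_of_forall_rat (fun μ μ' => ?_) hy
  rw [← integral_sub (hν μ) (hν μ')]
  refine abs_integral_le_integral_abs.trans ?_
  refine (integral_mono ((hν μ).sub (hν μ')).abs (integrable_const _)
    fun y => abs_cauchyLoss_sub_le y μ μ').trans ?_
  simp

lemma map_neg_seqLaw (hν : ν.map (fun x => -x) = ν) :
    (seqLaw ν).map (fun y i => -y i) = seqLaw ν := by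
  have := Measure.infinitePi_map_pi (μ := fun _ : ℕ => ν) (f := fun _ x => -x)
    fun _ => measurable_neg
  rw [this]
  simp only [hν]

/-- By the central limit theorem, centered sums of `n` terms are unlikely to be small compared to
`√ n`. -/
lemma exists_eventually_measure_abs_sum_le {f : ℝ → ℝ} (hf : Measurable f)
    (h0 : ∫ x, f x ∂ν = 0) (h2 : 0 < ∫ x, f x ^ 2 ∂ν) {ρ : ENNReal} (hρ : 0 < ρ) :
    ∃ ε > 0, ∀ᶠ n : ℕ in atTop,
      seqLaw ν {y | |∑ i ∈ Finset.range n, f (y i)| ≤ ε * √n} < ρ := by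
  set σ := √(∫ x, f x ^ 2 ∂ν) with hσ
  have hσ0 : 0 < σ := Real.sqrt_pos.2 h2
  have hfσ : Measurable fun x => f x / σ := hf.div_const σ
  have hclt := tendstoInDistribution_inv_sqrt_mul_sum (P := seqLaw ν)
    (P' := gaussianReal 0 1) (Y := id) (X := fun i y => f (y i) / σ) ⟨by fun_prop, Measure.map_id⟩
    (by
      have := integral_eval_seqLaw ν hfσ 0
      rw [this, integral_div, h0, zero_div])
    (by
      have := integral_eval_seqLaw ν (hfσ.pow_const 2) 0
      simp only [Pi.pow_apply]
      rw [this]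
      simp only [div_pow]
      rw [integral_div, hσ, Real.sq_sqrt h2.le, div_self h2.ne'])
    (iIndepFun_seqLaw ν hfσ) (identDistrib_seqLaw ν hfσ)
  -- The Gaussian limit has no atom at 0, so some closed ball around 0 has mass below `ρ`; the
  -- portmanteau theorem for closed sets carries this to large `n`.
  obtain ⟨U, hU0, hUo, hUρ⟩ := Set.exists_isOpen_lt_of_lt (μ := gaussianReal 0 1) {(0 : ℝ)} ρ
    (by
      have := nullSingletonClass_gaussianReal (μ := 0) (v := 1) one_ne_zero
      simpa using hρ)
  obtain ⟨r, hr, hrU⟩ := Metric.nhds_basis_closedBall.mem_iff.1 (hUo.mem_nhds (hU0 rfl))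
  refine ⟨r * σ, by positivity, ?_⟩
  have hlim := ProbabilityMeasure.limsup_measure_closed_le_of_tendsto hclt.tendsto
    (Metric.isClosed_closedBall (x := (0 : ℝ)) (ε := r))
  have hlt : (gaussianReal 0 1) (Metric.closedBall 0 r) < ρ := (measure_mono hrU).trans_lt hUρ
  have hev := eventually_lt_of_limsup_lt (hlim.trans_lt (by simpa using hlt))
  filter_upwards [hev, eventually_gt_atTop 0] with n hn hn0
  refine lt_of_le_of_lt ?_ hn
  have hn' : 0 < √(n : ℝ) := Real.sqrt_pos.2 (Nat.cast_pos.2 hn0)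
  simp only [ProbabilityMeasure.coe_mk]
  rw [Measure.map_apply (by fun_prop) Metric.isClosed_closedBall.measurableSet]
  refine measure_mono fun y hy => ?_
  simp only [Set.mem_preimage, mem_closedBall_zero_iff, Real.norm_eq_abs]
  rw [← Finset.sum_div, abs_mul, abs_div, abs_of_pos hσ0, abs_inv, abs_of_pos hn', inv_mul_le_iff₀ hn',
    div_le_iff₀ hσ0]
  calc _ ≤ r * σ * √n := hy
    _ = _ := by ring

/-- A centered sum of `n` independent bounded terms has first absolute moment `O(√ n)`. -/
lemma lintegral_enorm_sum_le {f : ℝ → ℝ} (hf : Measurable f) {B : ℝ} (hB : ∀ x, |f x| ≤ B)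
    (h0 : ∫ x, f x ∂ν = 0) {n : ℕ} (hn : 0 < n) :
    ∫⁻ y, ‖∑ i ∈ Finset.range n, f (y i)‖ₑ ∂seqLaw ν ≤ ENNReal.ofReal ((B ^ 2 + 1) * √n) := by
  have hn' : 0 < √(n : ℝ) := Real.sqrt_pos.2 (Nat.cast_pos.2 hn)
  have hmem : ∀ i : ℕ, MemLp (fun y : ℕ → ℝ => f (y i)) 2 (seqLaw ν) := fun i =>
    MemLp.of_bound (hf.comp (measurable_pi_apply i)).aestronglyMeasurable B (ae_of_all _ fun y => hB _)
  have hint : ∀ i : ℕ, Integrable (fun y : ℕ → ℝ => f (y i)) (seqLaw ν) := fun i =>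
    (hmem i).integrable one_le_two
  set S : (ℕ → ℝ) → ℝ := fun y => ∑ i ∈ Finset.range n, f (y i) with hS
  have hSmem : MemLp S 2 (seqLaw ν) := memLp_finsetSum _ fun i _ => hmem i
  have hSmean : ∫ y, S y ∂seqLaw ν = 0 := by
    rw [hS, integral_finsetSum _ fun i _ => hint i]
    simp [integral_eval_seqLaw ν hf, h0]
  have hterm : ∀ i : ℕ, Var[fun y : ℕ → ℝ => f (y i); seqLaw ν] ≤ B ^ 2 := fun i => by
    rw [variance_of_integral_eq_zero (hint i).aemeasurable
      (by rw [integral_eval_seqLaw ν hf, h0])]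
    have : ∀ y : ℕ → ℝ, f (y i) ^ 2 ≤ B ^ 2 := fun y => by
      rw [← sq_abs]; exact pow_le_pow_left₀ (abs_nonneg _) (hB _) 2
    calc _ ≤ ∫ y : ℕ → ℝ, B ^ 2 ∂seqLaw ν :=
          integral_mono (hmem i).integrable_sq (integrable_const _) this
      _ = B ^ 2 := by simp
  have hvar : ∫ y, S y ^ 2 ∂seqLaw ν ≤ n * B ^ 2 := by
    have h1 := variance_of_integral_eq_zero hSmem.aemeasurable hSmean
    rw [← h1]
    have h2 : S = ∑ i ∈ Finset.range n, fun y : ℕ → ℝ => f (y i) := by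
      ext y; simp [hS]
    rw [h2, IndepFun.variance_sum (fun i _ => hmem i)
      fun i _ j _ hij => (iIndepFun_seqLaw ν hf).indepFun hij]
    refine (Finset.sum_le_sum fun i _ => hterm i).trans (by simp)
  have hSint : Integrable S (seqLaw ν) := hSmem.integrable one_le_two
  -- This pointwise inequality turns the variance bound `n * B ^ 2` into a first-moment bound of
  -- order `√n`.
  have hpt : ∀ y, |S y| ≤ S y ^ 2 / √n + √n := fun y => by
    rw [div_add' _ _ _ hn'.ne', le_div_iff₀ hn', ← sq_abs (S y)]
    nlinarith [sq_nonneg (|S y| - √(n : ℝ)), abs_nonneg (S y)]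
  have hreal : ∫ y, |S y| ∂seqLaw ν ≤ (B ^ 2 + 1) * √n := by
    calc _ ≤ ∫ y, (S y ^ 2 / √n + √n) ∂seqLaw ν :=
          integral_mono hSint.abs ((hSmem.integrable_sq.div_const _).add (integrable_const _)) hpt
      _ = (∫ y, S y ^ 2 ∂seqLaw ν) / √n + √n := by
          rw [integral_add (hSmem.integrable_sq.div_const _) (integrable_const _), integral_div]
          simp
      _ ≤ n * B ^ 2 / √n + √n := by gcongr
      _ = (B ^ 2 + 1) * √n := by
          have : (n : ℝ) = √n * √n := (Real.mul_self_sqrt (Nat.cast_nonneg n)).symm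
          field_simp
          rw [sq (√(n : ℝ)), ← this]
          ring
  have := ofReal_integral_norm_eq_lintegral_enorm hSint
  rw [← this]
  exact ENNReal.ofReal_le_ofReal hreal

end Sequence

/-! ### The log likelihood ratio between opposite parameters. -/

/-- The difference of the losses of the parameters `-μ` and `μ`, as an odd function of the
observation `y`. -/
noncomputable def lossDiff (μ y : ℝ) : ℝ := cauchyLoss (-y) μ - cauchyLoss y μ

/-- The derivative of `lossDiff` in the parameter. -/
noncomputable def lossDiffDeriv (μ y : ℝ) : ℝ :=
  2 * (μ - -y) / (1 + (μ - -y) ^ 2) - 2 * (μ - y) / (1 + (μ - y) ^ 2)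

lemma lossDiff_neg (μ y : ℝ) : lossDiff μ (-y) = -lossDiff μ y := by simp [lossDiff]

lemma lossDiffDeriv_neg (μ y : ℝ) : lossDiffDeriv μ (-y) = -lossDiffDeriv μ y := by
  simp [lossDiffDeriv]

lemma measurable_lossDiff (μ : ℝ) : Measurable (lossDiff μ) :=
  ((measurable_cauchyLoss μ).comp measurable_neg).sub (measurable_cauchyLoss μ)

lemma continuous_lossDiffDeriv : Continuous fun p : ℝ × ℝ => lossDiffDeriv p.1 p.2 := by
  unfold lossDiffDeriv
  exact ((by fun_prop : Continuous _).div (by fun_prop) fun p => by positivity).sub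
    ((by fun_prop : Continuous _).div (by fun_prop) fun p => by positivity)

lemma measurable_lossDiffDeriv (μ : ℝ) : Measurable (lossDiffDeriv μ) :=
  (continuous_lossDiffDeriv.comp (by fun_prop : Continuous fun y : ℝ => (μ, y))).measurable

lemma abs_lossDiffDeriv_le (μ y : ℝ) : |lossDiffDeriv μ y| ≤ 2 := by
  have h1 := abs_two_mul_div_one_add_sq_le (μ - -y)
  have h2 := abs_two_mul_div_one_add_sq_le (μ - y)
  unfold lossDiffDeriv
  rw [abs_le] at *
  constructor <;> linarith [h1.1, h1.2, h2.1, h2.2]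

/-- Although the loss is unbounded in `y`, the difference is bounded by the Lipschitz estimate, so
second moments are available. -/
lemma abs_lossDiff_le (μ y : ℝ) : |lossDiff μ y| ≤ 2 * |μ| := by
  have h := abs_cauchyLoss_sub_le y (-μ) μ
  rw [lossDiff, show cauchyLoss (-y) μ = cauchyLoss y (-μ) by
    rw [← cauchyLoss_neg_neg, neg_neg]]
  refine h.trans (le_of_eq ?_)
  rw [show -μ - μ = -(2 * μ) by ring, abs_neg, abs_mul, abs_two]

lemma lossDiff_ne_zero {μ y : ℝ} (hμ : μ ≠ 0) (hy : y ≠ 0) : lossDiff μ y ≠ 0 := by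
  intro h
  unfold lossDiff cauchyLoss at h
  have h1 := Real.log_injOn_pos (Set.mem_Ioi.2 (by positivity)) (Set.mem_Ioi.2 (by positivity))
    (sub_eq_zero.1 h)
  have h2 : y * μ = 0 := by linarith
  exact (mul_ne_zero hy hμ) h2

lemma hasDerivAt_lossDiff (y μ : ℝ) :
    HasDerivAt (fun μ => lossDiff μ y) (lossDiffDeriv μ y) μ :=
  (hasDerivAt_cauchyLoss (-y) μ).sub (hasDerivAt_cauchyLoss y μ)

/-- Exhibits the log likelihood ratio of `μ` against `-μ` as a random walk. For a symmetric data law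
its steps are centered, being odd. -/
lemma totalLoss_neg_sub (y : ℕ → ℝ) (n : ℕ) (μ : ℝ) :
    totalLoss y n (-μ) - totalLoss y n μ = ∑ i ∈ Finset.range n, lossDiff μ (y i) := by
  simp only [totalLoss, lossDiff, Finset.sum_sub_distrib]
  congr 1
  refine Finset.sum_congr rfl fun i _ => ?_
  rw [← cauchyLoss_neg_neg, neg_neg]

lemma integral_eq_zero_of_odd {ν : Measure ℝ} (hν : ν.map (fun x => -x) = ν) {f : ℝ → ℝ}
    (hf : ∀ x, f (-x) = -f x) : ∫ x, f x ∂ν = 0 := by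
  have h : ∫ x, f x ∂ν = ∫ x, f (-x) ∂ν := by
    conv_lhs => rw [← hν]
    exact integral_map_equiv (MeasurableEquiv.neg ℝ) f
  simp only [hf, integral_neg] at h
  linarith

/-- The integral over `ball γ δ` of the derivative of the loss difference controls the
oscillation of the loss difference on this interval. -/
lemma ofReal_abs_sum_lossDiff_sub_le (y : ℕ → ℝ) (n : ℕ) {γ δ μ : ℝ}
    (hμ : μ ∈ Metric.ball γ δ) :
    ENNReal.ofReal |∑ i ∈ Finset.range n, lossDiff μ (y i) -
        ∑ i ∈ Finset.range n, lossDiff γ (y i)| ≤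
      ∫⁻ s in Metric.ball γ δ, ‖∑ i ∈ Finset.range n, lossDiffDeriv s (y i)‖ₑ := by
  have hcont : Continuous fun s => ∑ i ∈ Finset.range n, lossDiffDeriv s (y i) :=
    continuous_finsetSum _ fun i _ =>
      continuous_lossDiffDeriv.comp (by fun_prop : Continuous fun s : ℝ => (s, y i))
  have hFTC := intervalIntegral.integral_eq_sub_of_hasDerivAt (a := γ) (b := μ)
    (f := fun s => ∑ i ∈ Finset.range n, lossDiff s (y i))
    (fun s _ => HasDerivAt.fun_sum fun i _ => hasDerivAt_lossDiff (y i) s)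
    (hcont.intervalIntegrable _ _)
  rw [← hFTC, ← Real.norm_eq_abs, ofReal_norm,
    show ‖∫ s in γ..μ, ∑ i ∈ Finset.range n, lossDiffDeriv s (y i)‖ₑ =
      ‖∫ s in Set.uIoc γ μ, ∑ i ∈ Finset.range n, lossDiffDeriv s (y i)‖ₑ by
      rw [← ofReal_norm, ← ofReal_norm,
        intervalIntegral.norm_intervalIntegral_eq]]
  refine (enorm_integral_le_lintegral_enorm _).trans (lintegral_mono_set ?_)
  have hγ : γ ∈ Metric.ball γ δ := Metric.mem_ball_self (dist_nonneg.trans_lt (Metric.mem_ball.1 hμ))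
  refine Set.uIoc_subset_uIcc.trans ?_
  exact ((convex_ball γ δ).ordConnected).uIcc_subset hγ hμ

/-! ### Separation of the two modes with high probability. -/

section Selection

variable {ν : Measure ℝ} [IsProbabilityMeasure ν]

/-- Tonelli reduces this to the moment bound for each `s`, which is `5 * √n` with `B = 2`, over a
ball of length `2 * δ`. Linearity in `δ` makes the oscillation small compared with `√n`. -/
lemma lintegral_lintegral_lossDiffDeriv_le (hν : ν.map (fun x => -x) = ν) {γ δ : ℝ}
    {n : ℕ} (hn : 0 < n) :
    ∫⁻ y, (∫⁻ s in Metric.ball γ δ, ‖∑ i ∈ Finset.range n, lossDiffDeriv s (y i)‖ₑ) ∂seqLaw ν ≤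
      ENNReal.ofReal (10 * δ * √n) := by
  have hcont : Continuous fun p : (ℕ → ℝ) × ℝ =>
      ∑ i ∈ Finset.range n, lossDiffDeriv p.2 (p.1 i) :=
    continuous_finsetSum _ fun i _ => continuous_lossDiffDeriv.comp
      (by fun_prop : Continuous fun p : (ℕ → ℝ) × ℝ => (p.2, p.1 i))
  rw [lintegral_lintegral_swap hcont.measurable.enorm.aemeasurable]
  refine (lintegral_mono fun s => lintegral_enorm_sum_le ν (measurable_lossDiffDeriv s)
    (abs_lossDiffDeriv_le s) (integral_eq_zero_of_odd hν (lossDiffDeriv_neg s)) hn).trans ?_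
  rw [setLIntegral_const, Real.volume_ball, ← ENNReal.ofReal_mul (by positivity)]
  apply ENNReal.ofReal_le_ofReal
  nlinarith [Real.sqrt_nonneg (n : ℝ)]

/-- With high probability, the log likelihood ratio between `μ` and `-μ` is either large and
positive for all `μ` near `γ`, or large and negative for all `μ` near `γ`. -/
lemma exists_eventually_measure_not_separated (hν : ν.map (fun x => -x) = ν) (hν0 : ν {0} = 0)
    {γ δ₀ : ℝ} (hγ : γ ≠ 0) (hδ₀ : 0 < δ₀) {ρ : ENNReal} (hρ : 0 < ρ) :
    ∃ δ, 0 < δ ∧ δ ≤ δ₀ ∧ ∀ T : ℝ, ∀ᶠ n : ℕ in atTop,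
      seqLaw ν {y | ¬ ((∀ μ ∈ Metric.ball γ δ, T ≤ totalLoss y n (-μ) - totalLoss y n μ) ∨
        ∀ μ ∈ Metric.ball γ δ, T ≤ totalLoss y n μ - totalLoss y n (-μ))} ≤ ρ := by
  have hbound : ∀ y, lossDiff γ y ^ 2 ≤ (2 * |γ|) ^ 2 := fun y => by
    rw [← sq_abs]
    exact pow_le_pow_left₀ (abs_nonneg _) (abs_lossDiff_le γ y) 2
  have hint : Integrable (fun y => lossDiff γ y ^ 2) ν :=
    (integrable_const ((2 * |γ|) ^ 2)).mono' ((measurable_lossDiff γ).pow_const 2).aestronglyMeasurable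
      (ae_of_all _ fun y => by rw [Real.norm_of_nonneg (sq_nonneg _)]; exact hbound y)
  have hvar : 0 < ∫ y, lossDiff γ y ^ 2 ∂ν := by
    rw [integral_pos_iff_support_of_nonneg (fun y => sq_nonneg _) hint]
    have h1 : ν {(0 : ℝ)}ᶜ = 1 := by rw [prob_compl_eq_one_iff (measurableSet_singleton 0)]; exact hν0
    refine lt_of_lt_of_le ?_ (measure_mono (s := {(0 : ℝ)}ᶜ) fun y hy => ?_)
    · rw [h1]; exact one_pos
    · exact pow_ne_zero 2 (lossDiff_ne_zero hγ hy)
  have hρ2 : 0 < ρ / 2 := ENNReal.half_pos hρ.ne'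
  obtain ⟨ε, hε, hclt⟩ := exists_eventually_measure_abs_sum_le ν (measurable_lossDiff γ)
    (integral_eq_zero_of_odd hν (lossDiff_neg γ)) hvar hρ2
  obtain ⟨r, hr0, hr⟩ : ∃ r : ℝ, 0 < r ∧ ENNReal.ofReal r ≤ ρ / 2 := by
    obtain ⟨r, hr0, hr⟩ := ENNReal.lt_iff_exists_nnreal_btwn.1 hρ2
    refine ⟨r, by exact_mod_cast hr0, by rw [ENNReal.ofReal_coe_nnreal]; exact hr.le⟩
  -- Markov's inequality at level `ε / 2 * √n` gives probability at most `20 * δ / ε`, which this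
  -- choice keeps below `r`.
  set δ := min δ₀ (ε * r / 20) with hδdef
  have hδ : 0 < δ := lt_min hδ₀ (by positivity)
  have hδr : 20 * δ ≤ ε * r := by
    have : δ ≤ ε * r / 20 := min_le_right _ _
    linarith
  refine ⟨δ, hδ, min_le_left _ _, fun T => ?_⟩
  have hT : ∀ᶠ n : ℕ in atTop, T ≤ ε / 2 * √(n : ℝ) :=
    ((Real.tendsto_sqrt_atTop.comp tendsto_natCast_atTop_atTop).const_mul_atTop
      (half_pos hε)).eventually_ge_atTop T
  filter_upwards [hclt, hT, eventually_gt_atTop 0] with n h1 h2 hn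
  have hn' : 0 < √(n : ℝ) := Real.sqrt_pos.2 (Nat.cast_pos.2 hn)
  set V : (ℕ → ℝ) → ENNReal := fun y =>
    ∫⁻ s in Metric.ball γ δ, ‖∑ i ∈ Finset.range n, lossDiffDeriv s (y i)‖ₑ with hV
  have hVE := lintegral_lintegral_lossDiffDeriv_le hν (γ := γ) (δ := δ) hn
  have hc0 : 0 < ε / 2 * √(n : ℝ) := by positivity
  have hmark : seqLaw ν {y | ENNReal.ofReal (ε / 2 * √n) ≤ V y} ≤ ρ / 2 := by
    refine (meas_ge_le_lintegral_div ?_ (ENNReal.ofReal_pos.2 hc0).ne'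
      ENNReal.ofReal_ne_top).trans ?_
    · have hcont : Continuous fun p : (ℕ → ℝ) × ℝ =>
          ∑ i ∈ Finset.range n, lossDiffDeriv p.2 (p.1 i) :=
        continuous_finsetSum _ fun i _ => continuous_lossDiffDeriv.comp
          (by fun_prop : Continuous fun p : (ℕ → ℝ) × ℝ => (p.2, p.1 i))
      exact (Measurable.lintegral_prod_right' hcont.measurable.enorm).aemeasurable
    · refine le_trans ?_ hr
      refine ENNReal.div_le_of_le_mul (hVE.trans ?_)
      rw [← ENNReal.ofReal_mul hr0.le]
      apply ENNReal.ofReal_le_ofReal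
      nlinarith
  -- Off these two events the walk at `γ` exceeds `ε * √n` in absolute value and moves by less than
  -- half of that on the ball, so its sign is constant there and its size at least `T`.
  calc _ ≤ seqLaw ν ({y | |∑ i ∈ Finset.range n, lossDiff γ (y i)| ≤ ε * √n} ∪
        {y | ENNReal.ofReal (ε / 2 * √n) ≤ V y}) := measure_mono fun y hy => ?_
    _ ≤ ρ / 2 + ρ / 2 := (measure_union_le _ _).trans (add_le_add h1.le hmark)
    _ = ρ := ENNReal.add_halves ρ
  by_contra hcon
  simp only [Set.mem_union, Set.mem_ofPred_eq, not_or, not_le] at hcon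
  obtain ⟨hD, hVy⟩ := hcon
  have hosc : ∀ μ ∈ Metric.ball γ δ, |∑ i ∈ Finset.range n, lossDiff μ (y i) -
      ∑ i ∈ Finset.range n, lossDiff γ (y i)| < ε / 2 * √n := fun μ hμ =>
    (ENNReal.ofReal_lt_ofReal_iff hc0).1 ((ofReal_abs_sum_lossDiff_sub_le y n hμ).trans_lt hVy)
  refine hy ?_
  rcases lt_abs.1 hD with h | h
  · refine Or.inl fun μ hμ => ?_
    rw [totalLoss_neg_sub]
    have := (abs_lt.1 (hosc μ hμ)).1
    linarith
  · refine Or.inr fun μ hμ => ?_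
    rw [← neg_sub, totalLoss_neg_sub]
    have := (abs_lt.1 (hosc μ hμ)).2
    linarith

end Selection

lemma eventually_measure_le_lt_of_ae_tendsto_zero {α : Type*} [MeasurableSpace α] {Q : Measure α}
    [IsFiniteMeasure Q] {X : ℕ → α → ℝ} (hX : ∀ n, Measurable (X n))
    (h : ∀ᵐ y ∂Q, Tendsto (fun n => X n y) atTop (𝓝 0)) {κ : ℝ} {ρ : ENNReal} (hκ : 0 < κ)
    (hρ : 0 < ρ) : ∀ᶠ n in atTop, Q {y | κ ≤ X n y} < ρ := by
  have h1 := tendstoInMeasure_of_tendsto_ae (g := fun _ => (0 : ℝ))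
    (fun n => (hX n).aestronglyMeasurable) h
  filter_upwards [((tendstoInMeasure_iff_norm.1 h1) κ hκ).eventually_lt_const hρ] with n hn
  refine (measure_mono fun y hy => ?_).trans_lt hn
  simpa using (show κ ≤ X n y from hy).trans (le_abs_self _)

/-! ### Symmetric priors: each point is selected with probability 1/2. -/

section Symmetric

variable {prior : Measure ℝ}

lemma likelihoodMass_preimage_neg (hprior : prior.map (fun μ => -μ) = prior) (y : ℕ → ℝ) (n : ℕ)
    (s : Set ℝ) :
    likelihoodMass prior y n ((fun μ => -μ) ⁻¹' s) =
      ∫⁻ μ in s, cauchyLikelihood y n (-μ) ∂prior := by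
  have hmp : MeasurePreserving (fun μ : ℝ => -μ) prior prior := ⟨measurable_neg, hprior⟩
  have := hmp.setLIntegral_comp_preimage_emb (MeasurableEquiv.neg ℝ).measurableEmbedding
    (fun μ => cauchyLikelihood y n (-μ)) s
  simpa [likelihoodMass] using this

lemma cauchyLikelihood_neg_neg (y : ℕ → ℝ) (n : ℕ) (μ : ℝ) :
    cauchyLikelihood (fun i => -y i) n μ = cauchyLikelihood y n (-μ) := by
  rw [cauchyLikelihood_eq, cauchyLikelihood_eq, ← totalLoss_neg_neg y n (-μ), neg_neg]

lemma likelihoodMass_neg (hprior : prior.map (fun μ => -μ) = prior) (y : ℕ → ℝ) (n : ℕ)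
    (s : Set ℝ) :
    likelihoodMass prior (fun i => -y i) n s =
      likelihoodMass prior y n ((fun μ => -μ) ⁻¹' s) := by
  rw [likelihoodMass_preimage_neg hprior, likelihoodMass]
  simp only [cauchyLikelihood_neg_neg]

lemma cauchyPosterior_neg (hprior : prior.map (fun μ => -μ) = prior) (y : ℕ → ℝ) (n : ℕ)
    {s : Set ℝ} (hs : MeasurableSet s) :
    cauchyPosterior prior (fun i => -y i) n s =
      cauchyPosterior prior y n ((fun μ => -μ) ⁻¹' s) := by
  rw [cauchyPosterior_apply prior _ n hs, cauchyPosterior_apply prior _ n (measurable_neg hs),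
    likelihoodMass_neg hprior, likelihoodMass_neg hprior, Set.preimage_univ]

lemma preimage_neg_ball (γ η : ℝ) :
    (fun μ : ℝ => -μ) ⁻¹' Metric.ball γ η = Metric.ball (-γ) η := by
  ext μ
  simp only [Set.mem_preimage, Metric.mem_ball, Real.dist_eq]
  rw [← abs_neg, show -(-μ - γ) = μ - -γ by ring]

/-- If the log likelihood of `μ` exceeds that of `-μ` by at least `T` for all `μ ∈ s`, then the
posterior mass of `-s` is at most `exp (-T)`. -/
lemma cauchyPosterior_preimage_neg_le (hprior : prior.map (fun μ => -μ) = prior) {y : ℕ → ℝ}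
    {n : ℕ} {s : Set ℝ} (hs : MeasurableSet s) {T : ℝ}
    (h : ∀ μ ∈ s, T ≤ totalLoss y n (-μ) - totalLoss y n μ) :
    cauchyPosterior prior y n ((fun μ => -μ) ⁻¹' s) ≤ ENNReal.ofReal (Real.exp (-T)) := by
  have hmass : likelihoodMass prior y n ((fun μ => -μ) ⁻¹' s) ≤
      ENNReal.ofReal (Real.exp (-T)) * likelihoodMass prior y n s := by
    rw [likelihoodMass_preimage_neg hprior, likelihoodMass,
      ← lintegral_const_mul' _ _ ENNReal.ofReal_ne_top]
    refine setLIntegral_mono' hs fun μ hμ => ?_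
    rw [cauchyLikelihood_eq, cauchyLikelihood_eq, ← ENNReal.ofReal_mul (by positivity)]
    apply ENNReal.ofReal_le_ofReal
    rw [mul_left_comm, ← Real.exp_add]
    gcongr
    linarith [h μ hμ]
  calc _ ≤ ENNReal.ofReal (Real.exp (-T)) * cauchyPosterior prior y n s := by
        rw [cauchyPosterior_apply prior y n hs, cauchyPosterior_apply prior y n (measurable_neg hs),
          mul_left_comm]
        gcongr
    _ ≤ _ := mul_le_of_le_one_right zero_le (cauchyPosterior_le_one prior y n s)

lemma cauchyPosterior_le_of_preimage_neg (hprior : prior.map (fun μ => -μ) = prior) {y : ℕ → ℝ}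
    {n : ℕ} {s : Set ℝ} (hs : MeasurableSet s) {T : ℝ}
    (h : ∀ μ ∈ s, T ≤ totalLoss y n μ - totalLoss y n (-μ)) :
    cauchyPosterior prior y n s ≤ ENNReal.ofReal (Real.exp (-T)) := by
  have := cauchyPosterior_preimage_neg_le hprior (y := y) (n := n) (measurable_neg hs) (T := T)
    fun μ hμ => by simpa using h (-μ) hμ
  rwa [← Set.preimage_comp, show ((fun μ : ℝ => -μ) ∘ fun μ => -μ) = id by ext; simp,
    Set.preimage_id] at this

lemma measurable_real_cauchyPosterior [SFinite prior] (n : ℕ) {s : Set ℝ} (hs : MeasurableSet s) :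
    Measurable fun y => (cauchyPosterior prior y n).real s :=
  (measurable_cauchyPosterior prior n hs).ennreal_toReal

variable [prior.IsOpenPosMeasure] [prior.HasTemperateGrowth] {ν : Measure ℝ}
  [IsProbabilityMeasure ν] {γ : ℝ}

/-- The posterior masses of the neighbourhoods of `γ` and `-γ` are asymptotically on different sides
of every threshold in `(0, 1)`. -/
lemma tendsto_measure_same_side (hprior : prior.map (fun μ => -μ) = prior)
    (hν : ν.map (fun x => -x) = ν) (hν0 : ν {0} = 0)
    (hint : ∀ μ, Integrable (fun y => cauchyLoss y μ) ν) (hγ : 0 < γ)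
    (hmin : ∀ μ, μ ≠ γ → μ ≠ -γ → ∫ y, cauchyLoss y γ ∂ν < ∫ y, cauchyLoss y μ ∂ν)
    {η : ℝ} (hη : 0 < η) (hηγ : η < 2 * γ) {t : ℝ} (ht0 : 0 < t) (ht1 : t < 1) :
    Tendsto (fun n => seqLaw ν {y |
      (t < (cauchyPosterior prior y n).real (Metric.ball γ η) ↔
        t < (cauchyPosterior prior y n).real (Metric.ball (-γ) η))}) atTop (𝓝 0) := by
  rw [ENNReal.tendsto_nhds_zero]
  intro ρ hρ
  have hρ2 : 0 < ρ / 2 := ENNReal.half_pos hρ.ne'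
  -- The three bounds on `δ` put the `δ`-balls inside the `η`-balls, keep them disjoint, and keep
  -- each `δ`-ball disjoint from the `η`-ball around the opposite point.
  obtain ⟨δ, hδ, hδ₀, hsep⟩ := exists_eventually_measure_not_separated hν hν0 (γ := γ)
    (δ₀ := min (min η γ) (2 * γ - η)) hγ.ne' (by
      refine lt_min (lt_min hη hγ) (by linarith)) hρ2
  have hδη : δ ≤ η := hδ₀.trans ((min_le_left _ _).trans (min_le_left _ _))
  have hδγ : δ ≤ γ := hδ₀.trans ((min_le_left _ _).trans (min_le_right _ _))
  have hδ2 : δ ≤ 2 * γ - η := hδ₀.trans (min_le_right _ _)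
  -- The losing ball and the remainder `F` each receive at most `κ`. So the loser's `η`-ball stays
  -- below `t` and the winner's exceeds `t`.
  set κ := min t (1 - t) / 2 with hκ
  have hκ0 : 0 < κ := half_pos (lt_min ht0 (by linarith))
  have hκt : 2 * κ ≤ t := by rw [hκ]; linarith [min_le_left t (1 - t)]
  have hκt' : 2 * κ ≤ 1 - t := by rw [hκ]; linarith [min_le_right t (1 - t)]
  set U := Metric.ball γ δ with hU
  set U' := Metric.ball (-γ) δ with hU'
  have hUU' : (fun μ : ℝ => -μ) ⁻¹' U = U' := preimage_neg_ball γ δ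
  set F := (U ∪ U')ᶜ with hF
  have hFc : IsClosed F := (Metric.isOpen_ball.union Metric.isOpen_ball).isClosed_compl
  have hae : ∀ᵐ y ∂seqLaw ν, Tendsto (fun n => (cauchyPosterior prior y n).real F) atTop
      (𝓝 0) := by
    filter_upwards [ae_tendsto_totalLoss_div ν hint] with y hy
    have h := (ENNReal.tendsto_toReal ENNReal.zero_ne_top).comp
      (tendsto_cauchyPosterior_zero prior hy hFc (γ := γ) fun μ hμ => hmin μ ?_ ?_)
    · rwa [ENNReal.toReal_zero] at h
    · rintro rfl; exact hμ (Or.inl (Metric.mem_ball_self hδ))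
    · rintro rfl; exact hμ (Or.inr (Metric.mem_ball_self hδ))
  have hsmall := eventually_measure_le_lt_of_ae_tendsto_zero
    (fun n => measurable_real_cauchyPosterior (prior := prior) n hFc.measurableSet) hae hκ0 hρ2
  obtain ⟨m, hm⟩ := eventually_isProbabilityMeasure_cauchyPosterior prior
  filter_upwards [hsep (-Real.log κ), hsmall, eventually_ge_atTop m] with n h1 h2 hmn
  refine le_trans (measure_mono (t := _ ∪ _) fun y hy => ?_)
    ((measure_union_le _ _).trans ((add_le_add h1 h2.le).trans (ENNReal.add_halves ρ).le))
  by_contra hcon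
  obtain ⟨hs, hFy⟩ := not_or.1 hcon
  replace hs := not_not.1 hs
  have := hm y n hmn
  set Q := cauchyPosterior prior y n with hQ
  have hFr : Q.real F < κ := not_le.1 hFy
  have hdisj : Disjoint U U' := Metric.ball_disjoint_ball (by
    rw [Real.dist_eq, abs_of_pos (by linarith)]; linarith)
  have hsum : Q.real U + Q.real U' + Q.real F = 1 := by
    rw [hF, ← measureReal_union hdisj Metric.isOpen_ball.measurableSet]
    exact probReal_add_probReal_compl
      (Metric.isOpen_ball.measurableSet.union Metric.isOpen_ball.measurableSet)
  have hle : ∀ {s : Set ℝ}, Q s ≤ ENNReal.ofReal (Real.exp (-(-Real.log κ))) → Q.real s ≤ κ :=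
    fun {s} h => by
      rw [neg_neg, Real.exp_log hκ0] at h
      exact ENNReal.toReal_le_of_le_ofReal hκ0.le h
  have hcov : ∀ c c' : ℝ, |c - c'| = 2 * γ → (Metric.ball c δ ∪ Metric.ball c' δ)ᶜ = F →
      Q.real (Metric.ball c η) ≤ Q.real (Metric.ball c δ) + Q.real F := fun c c' hcc hc => by
    refine (measureReal_mono (fun μ hμ => ?_)).trans (measureReal_union_le _ _)
    rw [← hc]
    by_cases h : μ ∈ Metric.ball c δ
    · exact Or.inl h
    · refine Or.inr fun h' => h'.elim h fun h'' => ?_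
      rw [Metric.mem_ball, Real.dist_eq] at hμ h''
      have := abs_sub_le c μ c'
      rw [abs_sub_comm c μ, hcc] at this
      linarith
  have hc1 := hcov γ (-γ) (by rw [sub_neg_eq_add, abs_of_pos (by linarith)]; ring) rfl
  have hc2 := hcov (-γ) γ (by
    rw [abs_sub_comm, sub_neg_eq_add, abs_of_pos (by linarith)]; ring) (by rw [Set.union_comm])
  have hm1 : Q.real U ≤ Q.real (Metric.ball γ η) := measureReal_mono (Metric.ball_subset_ball hδη)
  have hm2 : Q.real U' ≤ Q.real (Metric.ball (-γ) η) :=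
    measureReal_mono (Metric.ball_subset_ball hδη)
  rcases hs with hs | hs
  · have h3 : Q.real U' ≤ κ := hle (by
      rw [← hUU']
      exact cauchyPosterior_preimage_neg_le hprior Metric.isOpen_ball.measurableSet hs)
    have h4 : ¬ t < Q.real (Metric.ball (-γ) η) := by linarith
    have h5 := mt hy.1 h4
    linarith
  · have h3 : Q.real U ≤ κ := hle
      (cauchyPosterior_le_of_preimage_neg hprior Metric.isOpen_ball.measurableSet hs)
    have h4 : ¬ t < Q.real (Metric.ball γ η) := by linarith
    have h5 := mt hy.2 h4
    linarith

/-- Each of the points `γ` and `-γ` is selected with asymptotic probability `1 / 2`. -/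
theorem tendsto_measure_lt_cauchyPosterior_ball (hprior : prior.map (fun μ => -μ) = prior)
    (hν : ν.map (fun x => -x) = ν) (hν0 : ν {0} = 0)
    (hint : ∀ μ, Integrable (fun y => cauchyLoss y μ) ν) (hγ : 0 < γ)
    (hmin : ∀ μ, μ ≠ γ → μ ≠ -γ → ∫ y, cauchyLoss y γ ∂ν < ∫ y, cauchyLoss y μ ∂ν)
    {η : ℝ} (hη : 0 < η) (hηγ : η < 2 * γ) {t : ℝ} (ht0 : 0 < t) (ht1 : t < 1) :
    Tendsto (fun n => (seqLaw ν).real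
        {y | t < (cauchyPosterior prior y n).real (Metric.ball γ η)}) atTop (𝓝 (1 / 2)) ∧
      Tendsto (fun n => (seqLaw ν).real
        {y | t < (cauchyPosterior prior y n).real (Metric.ball (-γ) η)}) atTop (𝓝 (1 / 2)) := by
  set A : ℕ → Set (ℕ → ℝ) := fun n =>
    {y | t < (cauchyPosterior prior y n).real (Metric.ball γ η)} with hA
  set A' : ℕ → Set (ℕ → ℝ) := fun n =>
    {y | t < (cauchyPosterior prior y n).real (Metric.ball (-γ) η)} with hA'
  have hAm : ∀ n, MeasurableSet (A n) := fun n => measurableSet_lt measurable_const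
    (measurable_real_cauchyPosterior n Metric.isOpen_ball.measurableSet)
  have hA'm : ∀ n, MeasurableSet (A' n) := fun n => measurableSet_lt measurable_const
    (measurable_real_cauchyPosterior n Metric.isOpen_ball.measurableSet)
  -- Reflecting the data preserves their law and exchanges the two events.
  have heq : ∀ n, (seqLaw ν).real (A' n) = (seqLaw ν).real (A n) := fun n => by
    conv_rhs => rw [← map_neg_seqLaw ν hν]
    rw [map_measureReal_apply (by fun_prop) (hAm n)]
    congr 1
    ext y
    simp only [hA, hA', Set.mem_preimage, Set.mem_ofPred_eq, Measure.real]
    rw [cauchyPosterior_neg hprior y n Metric.isOpen_ball.measurableSet, preimage_neg_ball]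
  have hsame := tendsto_measure_same_side (prior := prior) hprior hν hν0 hint hγ hmin hη hηγ ht0 ht1
  have hsame' : Tendsto (fun n => (seqLaw ν).real {y | y ∈ A n ↔ y ∈ A' n}) atTop (𝓝 0) := by
    have h := (ENNReal.tendsto_toReal ENNReal.zero_ne_top).comp hsame
    rwa [ENNReal.toReal_zero] at h
  -- The events have equal probability, so twice it is the probability of their union plus that of
  -- their intersection. Both differ from 1 and 0 by at most the same-side probability.
  have hhalf : ∀ n, |(seqLaw ν).real (A n) - 1 / 2| ≤
      (seqLaw ν).real {y | y ∈ A n ↔ y ∈ A' n} := fun n => by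
    set S := {y | y ∈ A n ↔ y ∈ A' n} with hS
    have h1 : (seqLaw ν).real (A n ∩ A' n) ≤ (seqLaw ν).real S :=
      measureReal_mono fun y hy => by simp [hS, hy.1, hy.2]
    have h2 : (seqLaw ν).real (A n ∪ A' n)ᶜ ≤ (seqLaw ν).real S :=
      measureReal_mono fun y hy => by
        simp only [Set.mem_compl_iff, Set.mem_union, not_or] at hy
        simp [hS, hy.1, hy.2]
    have h3 := measureReal_union_add_inter (μ := seqLaw ν) (s := A n) (hA'm n)
    have h4 := probReal_compl_eq_one_sub (μ := seqLaw ν) ((hAm n).union (hA'm n))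
    have h5 := measureReal_nonneg (μ := seqLaw ν) (s := A n ∩ A' n)
    have h6 := measureReal_nonneg (μ := seqLaw ν) (s := (A n ∪ A' n)ᶜ)
    rw [heq n] at h3
    rw [abs_le]
    constructor <;> linarith [measureReal_nonneg (μ := seqLaw ν) (s := S)]
  have hlim : Tendsto (fun n => (seqLaw ν).real (A n)) atTop (𝓝 (1 / 2)) := by
    rw [tendsto_iff_norm_sub_tendsto_zero]
    exact squeeze_zero (fun n => norm_nonneg _) hhalf hsame'
  exact ⟨hlim, hlim.congr fun n => (heq n).symm⟩

end Symmetric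

/-! ### Oscillation by the zero-one law. -/

section Oscillation

variable (prior : Measure ℝ)

/-- The data sequences for which the ratio of the likelihood masses of the positive and the negative
half-line is unbounded. -/
def positiveDominates : Set (ℕ → ℝ) :=
  {y | ∀ j : ℕ, ∃ n, j ≤ n ∧
    j * likelihoodMass prior y n (Set.Iio 0) < likelihoodMass prior y n (Set.Ioi 0)}

lemma likelihoodMass_le_of_abs_totalLoss_sub_le {y z : ℕ → ℝ} {n : ℕ} {C : ℝ}
    (h : ∀ μ, |totalLoss y n μ - totalLoss z n μ| ≤ C) (s : Set ℝ) :
    likelihoodMass prior y n s ≤ ENNReal.ofReal (Real.exp C) * likelihoodMass prior z n s := by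
  rw [likelihoodMass, likelihoodMass, ← lintegral_const_mul' _ _ ENNReal.ofReal_ne_top]
  refine lintegral_mono fun μ => ?_
  rw [cauchyLikelihood_eq, cauchyLikelihood_eq, ← ENNReal.ofReal_mul (by positivity)]
  apply ENNReal.ofReal_le_ofReal
  rw [mul_left_comm, ← Real.exp_add]
  gcongr
  linarith [(abs_le.1 (h μ)).1]

/-- Whether a sequence lies in `positiveDominates` does not depend on finitely many of its terms. -/
lemma mem_positiveDominates_of_eventually_eq {y z : ℕ → ℝ} {k : ℕ} (h : ∀ i, k ≤ i → y i = z i)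
    (hz : z ∈ positiveDominates prior) : y ∈ positiveDominates prior := by
  obtain ⟨C, hC⟩ := exists_abs_totalLoss_sub_le h
  -- Changing finitely many terms alters the ratio of half-line masses by a factor of at most `exp C
  -- * exp C`. The added 1 gives `1 ≤ K`, hence `j ≤ j * K`.
  obtain ⟨K, hK⟩ := exists_nat_ge (Real.exp C * Real.exp C + 1)
  have hK1 : 1 ≤ K := by
    have : (1 : ℝ) ≤ K := by nlinarith [Real.exp_pos C]
    exact_mod_cast this
  intro j
  obtain ⟨n, hn, hlt⟩ := hz (j * K)
  refine ⟨n, (Nat.le_mul_of_pos_right j hK1).trans hn, ?_⟩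
  have h1 := likelihoodMass_le_of_abs_totalLoss_sub_le prior (fun μ => hC n μ) (Set.Iio 0)
  have h2 := likelihoodMass_le_of_abs_totalLoss_sub_le prior
    (fun μ => by rw [abs_sub_comm]; exact hC n μ) (Set.Ioi 0)
  set e := ENNReal.ofReal (Real.exp C) with he
  have heK : e * e ≤ K := by
    rw [he, ← ENNReal.ofReal_mul (Real.exp_pos C).le, ← ENNReal.ofReal_natCast]
    exact ENNReal.ofReal_le_ofReal (by linarith)
  refine lt_of_mul_lt_mul_left' (a := e) ?_
  calc e * (j * likelihoodMass prior y n (Set.Iio 0))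
      ≤ e * (j * (e * likelihoodMass prior z n (Set.Iio 0))) := by gcongr
    _ = j * (e * e) * likelihoodMass prior z n (Set.Iio 0) := by ring
    _ ≤ j * K * likelihoodMass prior z n (Set.Iio 0) := by gcongr
    _ < likelihoodMass prior z n (Set.Ioi 0) := by exact_mod_cast hlt
    _ ≤ e * likelihoodMass prior y n (Set.Ioi 0) := h2

lemma measurableSet_exists_le_mass_lt [SFinite prior] (j : ℕ) :
    MeasurableSet {y : ℕ → ℝ | ∃ n, j ≤ n ∧
      j * likelihoodMass prior y n (Set.Iio 0) < likelihoodMass prior y n (Set.Ioi 0)} := by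
  have : {y : ℕ → ℝ | ∃ n, j ≤ n ∧
      j * likelihoodMass prior y n (Set.Iio 0) < likelihoodMass prior y n (Set.Ioi 0)} =
      ⋃ n, ⋃ _ : j ≤ n, {y |
        j * likelihoodMass prior y n (Set.Iio 0) < likelihoodMass prior y n (Set.Ioi 0)} := by
    ext y; simp
  rw [this]
  exact MeasurableSet.iUnion fun n => MeasurableSet.iUnion fun _ =>
    measurableSet_lt ((measurable_likelihoodMass prior n _).const_mul _)
      (measurable_likelihoodMass prior n _)

lemma positiveDominates_eq_iInter :
    positiveDominates prior = ⋂ j : ℕ, {y : ℕ → ℝ | ∃ n, j ≤ n ∧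
      j * likelihoodMass prior y n (Set.Iio 0) < likelihoodMass prior y n (Set.Ioi 0)} := by
  ext y; simp [positiveDominates]

lemma measurableSet_positiveDominates [SFinite prior] :
    MeasurableSet (positiveDominates prior) := by
  rw [positiveDominates_eq_iInter]
  exact MeasurableSet.iInter (measurableSet_exists_le_mass_lt prior)

/-- Overwriting the first `k` terms by 0 does not change membership, so the event is a preimage
under a map that depends only on the coordinates from `k` on. -/
lemma measurableSet_tail_positiveDominates [SFinite prior] :
    MeasurableSet[limsup (fun i : ℕ => MeasurableSpace.comap (fun y : ℕ → ℝ => y i) inferInstance)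
      atTop] (positiveDominates prior) := by
  rw [limsup_eq_iInf_iSup_of_nat, MeasurableSpace.measurableSet_iInf]
  intro k
  have hpre : positiveDominates prior =
      (fun (y : ℕ → ℝ) (i : ℕ) => if i < k then 0 else y i) ⁻¹' positiveDominates prior := by
    ext y
    exact ⟨mem_positiveDominates_of_eventually_eq prior (k := k)
        fun i hi => by simp [not_lt.2 hi],
      mem_positiveDominates_of_eventually_eq prior (k := k) fun i hi => by simp [not_lt.2 hi]⟩
  rw [hpre]
  refine @MeasurableSet.preimage _ _ (_) (_) _ _ (measurableSet_positiveDominates prior) ?_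
  refine @measurable_pi_lambda _ _ _ (_) _ _ fun i => ?_
  by_cases hi : i < k
  · simp only [hi, if_true]
    exact @measurable_const _ _ _ (_) _
  · simp only [hi, if_false]
    refine Measurable.mono (comap_measurable fun y : ℕ → ℝ => y i) ?_ le_rfl
    exact le_iSup₂_of_le i (not_lt.1 hi) le_rfl

lemma seqLaw_positiveDominates_eq_zero_or_one [SFinite prior] (ν : Measure ℝ)
    [IsProbabilityMeasure ν] :
    seqLaw ν (positiveDominates prior) = 0 ∨ seqLaw ν (positiveDominates prior) = 1 :=
  measure_zero_or_one_of_measurableSet_limsup_atTop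
    (fun i => (measurable_pi_apply i).comap_le) (iIndepFun_seqLaw ν measurable_id)
    (measurableSet_tail_positiveDominates prior)

variable [prior.IsOpenPosMeasure]

lemma mul_cauchyPosterior_lt_iff {m : ℕ}
    (hm : ∀ y n, m ≤ n → IsProbabilityMeasure (cauchyPosterior prior y n)) (y : ℕ → ℝ) {n : ℕ}
    (hn : m ≤ n) (j : ℕ) {s t : Set ℝ} (hs : MeasurableSet s) (ht : MeasurableSet t) :
    j * likelihoodMass prior y n s < likelihoodMass prior y n t ↔
      j * (cauchyPosterior prior y n).real s < (cauchyPosterior prior y n).real t := by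
  have := hm y n hn
  have hZ0 := (likelihoodMass_pos prior y n).ne'
  have hZt : likelihoodMass prior y n Set.univ ≠ ⊤ := fun h => by
    have h1 := measure_univ (μ := cauchyPosterior prior y n)
    rw [cauchyPosterior_apply prior y n MeasurableSet.univ, h] at h1
    simp at h1
  have hmass : ∀ {u : Set ℝ}, MeasurableSet u → likelihoodMass prior y n u =
      likelihoodMass prior y n Set.univ * cauchyPosterior prior y n u := fun {u} hu => by
    rw [cauchyPosterior_apply prior y n hu, ENNReal.mul_inv_cancel_left hZ0 hZt]
  rw [hmass hs, hmass ht, mul_left_comm, ENNReal.mul_lt_mul_iff_right hZ0 hZt,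
    ← ENNReal.toReal_lt_toReal (ENNReal.mul_ne_top (ENNReal.natCast_ne_top j) (measure_ne_top _ _))
      (measure_ne_top _ _), ENNReal.toReal_mul, ENNReal.toReal_natCast]
  rfl

variable [prior.HasTemperateGrowth] {ν : Measure ℝ} [IsProbabilityMeasure ν] {γ : ℝ} {prior}

/-- The events `H j` decrease and each has probability at least 1/2, the limiting probability of
selecting `γ`. Their intersection is therefore not null, and the zero-one law makes it almost sure.
-/
lemma ae_mem_positiveDominates (hprior : prior.map (fun μ => -μ) = prior)
    (hν : ν.map (fun x => -x) = ν) (hν0 : ν {0} = 0)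
    (hint : ∀ μ, Integrable (fun y => cauchyLoss y μ) ν) (hγ : 0 < γ)
    (hmin : ∀ μ, μ ≠ γ → μ ≠ -γ → ∫ y, cauchyLoss y γ ∂ν < ∫ y, cauchyLoss y μ ∂ν) :
    ∀ᵐ y ∂seqLaw ν, y ∈ positiveDominates prior := by
  obtain ⟨m, hm⟩ := eventually_isProbabilityMeasure_cauchyPosterior prior
  set H : ℕ → Set (ℕ → ℝ) := fun j => {y : ℕ → ℝ | ∃ n, j ≤ n ∧
      j * likelihoodMass prior y n (Set.Iio 0) < likelihoodMass prior y n (Set.Ioi 0)} with hH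
  have hanti : Antitone H := fun i j hij y ⟨n, hn, hlt⟩ =>
    ⟨n, hij.trans hn, lt_of_le_of_lt (by gcongr) hlt⟩
  have hhalf : ∀ j, ENNReal.ofReal (1 / 2) ≤ seqLaw ν (H j) := fun j => by
    -- Mass above this threshold near `γ` leaves less than `1 / (j + 2)` for the negative half-line,
    -- a ratio above `j`. The ball used has radius `γ`, so it lies in the positive half-line.
    have ht1 : ((j : ℝ) + 1) / (j + 2) < 1 := by rw [div_lt_one (by positivity)]; linarith
    have hlim := (tendsto_measure_lt_cauchyPosterior_ball (prior := prior) hprior hν hν0 hint hγ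
      hmin hγ (by linarith) (t := ((j : ℝ) + 1) / (j + 2)) (by positivity) ht1).1
    refine ENNReal.ofReal_le_of_le_toReal (le_of_tendsto hlim ?_)
    filter_upwards [eventually_ge_atTop j, eventually_ge_atTop m] with n hj hmn
    refine measureReal_mono fun y hy => ⟨n, hj, ?_⟩
    rw [mul_cauchyPosterior_lt_iff prior hm y hmn j measurableSet_Iio measurableSet_Ioi]
    have := hm y n hmn
    set Q := cauchyPosterior prior y n
    have h1 : ((j : ℝ) + 1) / (j + 2) < Q.real (Set.Ioi 0) :=
      lt_of_lt_of_le hy (measureReal_mono fun μ hμ => by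
        have := (abs_lt.1 (Real.dist_eq μ γ ▸ Metric.mem_ball.1 hμ)).1
        exact Set.mem_Ioi.2 (by linarith))
    have h2 : Q.real (Set.Ioi 0) + Q.real (Set.Iio 0) ≤ 1 := by
      rw [← measureReal_union (Set.disjoint_left.2 fun μ h h' => lt_asymm (Set.mem_Ioi.1 h)
        (Set.mem_Iio.1 h')) measurableSet_Iio]
      exact measureReal_le_one
    rw [div_lt_iff₀ (by positivity)] at h1
    have h3 : (0 : ℝ) ≤ j := Nat.cast_nonneg j
    nlinarith [mul_le_mul_of_nonneg_left h2 h3, measureReal_nonneg (μ := Q) (s := Set.Iio 0)]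
  have hpos : seqLaw ν (positiveDominates prior) ≠ 0 := by
    rw [positiveDominates_eq_iInter, hanti.measure_iInter
      (fun j => (measurableSet_exists_le_mass_lt prior j).nullMeasurableSet)
      ⟨0, measure_ne_top _ _⟩]
    exact (lt_of_lt_of_le (by simp) (le_iInf hhalf)).ne'
  have hone := (seqLaw_positiveDominates_eq_zero_or_one prior ν).resolve_left hpos
  exact (mem_ae_iff_prob_eq_one (measurableSet_positiveDominates prior)).2 hone

lemma isClosed_compl_balls (γ η : ℝ) : IsClosed (Metric.ball γ η ∪ Metric.ball (-γ) η)ᶜ :=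
  (Metric.isOpen_ball.union Metric.isOpen_ball).isClosed_compl

lemma ae_tendsto_cauchyPosterior_compl_balls
    (hint : ∀ μ, Integrable (fun y => cauchyLoss y μ) ν)
    (hmin : ∀ μ, μ ≠ γ → μ ≠ -γ → ∫ y, cauchyLoss y γ ∂ν < ∫ y, cauchyLoss y μ ∂ν) :
    ∀ᵐ y ∂seqLaw ν, ∀ η, 0 < η → Tendsto (fun n => cauchyPosterior prior y n
      (Metric.ball γ η ∪ Metric.ball (-γ) η)ᶜ) atTop (𝓝 0) := by
  filter_upwards [ae_tendsto_totalLoss_div ν hint] with y hy η hη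
  refine tendsto_cauchyPosterior_zero prior hy (isClosed_compl_balls γ η) (γ := γ)
    fun μ hμ => hmin μ ?_ ?_
  · rintro rfl; exact hμ (Or.inl (Metric.mem_ball_self hη))
  · rintro rfl; exact hμ (Or.inr (Metric.mem_ball_self hη))

/-- At infinitely many `n` the negative half-line has mass below any prescribed `κ`. By consistency,
nearly all of the rest is then near `γ`. -/
lemma limsup_cauchyPosterior_ball_eq_one (hγ : 0 < γ) {y : ℕ → ℝ}
    (hy : y ∈ positiveDominates prior)
    (hcons : ∀ η, 0 < η → Tendsto (fun n => cauchyPosterior prior y n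
      (Metric.ball γ η ∪ Metric.ball (-γ) η)ᶜ) atTop (𝓝 0)) {η : ℝ} (hη : 0 < η) :
    limsup (fun n => cauchyPosterior prior y n (Metric.ball γ η)) atTop = 1 := by
  obtain ⟨m, hm⟩ := eventually_isProbabilityMeasure_cauchyPosterior prior
  refine le_antisymm (limsup_le_of_le (h := Eventually.of_forall fun n =>
    cauchyPosterior_le_one prior y n _)) (le_of_forall_lt fun b hb => ?_)
  obtain ⟨b', hbb', hb'⟩ := exists_between hb
  refine hbb'.trans_le (le_limsup_of_frequently_le (frequently_atTop.2 fun N => ?_))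
  have hbt : b' ≠ ⊤ := (hb'.trans ENNReal.one_lt_top).ne
  have hb1 : b'.toReal < 1 := by
    rw [← ENNReal.toReal_one]; exact (ENNReal.toReal_lt_toReal hbt ENNReal.one_ne_top).2 hb'
  -- Half of the allowed deficit `1 - b'` goes to the complement of the balls, half to the negative
  -- half-line.
  set κ := (1 - b'.toReal) / 2 with hκ
  have hκ0 : 0 < κ := by rw [hκ]; linarith
  -- Radius at most `γ` keeps the ball around `-γ` in the negative half-line.
  set r := min η γ with hr
  have hr0 : 0 < r := lt_min hη hγ
  set F := (Metric.ball γ r ∪ Metric.ball (-γ) r)ᶜ with hF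
  have hF0 : Tendsto (fun n => (cauchyPosterior prior y n).real F) atTop (𝓝 0) := by
    have h := (ENNReal.tendsto_toReal ENNReal.zero_ne_top).comp (hcons r hr0)
    rwa [ENNReal.toReal_zero] at h
  obtain ⟨N₁, hN₁⟩ := eventually_atTop.1 (hF0.eventually_lt_const hκ0)
  obtain ⟨J, hJ⟩ := exists_nat_gt (1 / κ)
  set j := max (max N N₁) (max J m) with hj
  obtain ⟨n, hn, hlt⟩ := hy j
  have hjN : N ≤ j := (le_max_left _ _).trans (le_max_left _ _)
  have hjN₁ : N₁ ≤ j := (le_max_right _ _).trans (le_max_left _ _)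
  have hjJ : J ≤ j := (le_max_left _ _).trans (le_max_right _ _)
  have hjm : m ≤ j := (le_max_right _ _).trans (le_max_right _ _)
  refine ⟨n, hjN.trans hn, ?_⟩
  rw [mul_cauchyPosterior_lt_iff prior hm y (hjm.trans hn) j measurableSet_Iio measurableSet_Ioi]
    at hlt
  have hFn := hN₁ n (hjN₁.trans hn)
  have := hm y n (hjm.trans hn)
  set Q := cauchyPosterior prior y n
  have hneg : Q.real (Set.Iio 0) < κ := by
    have h1 : (J : ℝ) ≤ j := Nat.cast_le.2 hjJ
    have h2 : (1 : ℝ) < j * κ := by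
      rw [div_lt_iff₀ hκ0] at hJ
      nlinarith
    have h3 : Q.real (Set.Ioi 0) ≤ 1 := measureReal_le_one
    by_contra! hcon
    have h4 : (j : ℝ) * κ ≤ j * Q.real (Set.Iio 0) := by gcongr
    linarith
  have hcover : (1 : ℝ) ≤ Q.real (Metric.ball γ η) + Q.real F + Q.real (Set.Iio 0) := by
    rw [← probReal_univ (μ := Q)]
    refine (measureReal_mono (s₂ := Metric.ball γ η ∪ F ∪ Set.Iio 0) fun μ _ => ?_).trans
      ((measureReal_union_le _ _).trans (add_le_add_left (measureReal_union_le _ _) _))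
    by_cases h1 : μ ∈ F
    · exact Or.inl (Or.inr h1)
    · rcases not_not.1 h1 with h2 | h2
      · exact Or.inl (Or.inl (Metric.ball_subset_ball (min_le_left _ _) h2))
      · refine Or.inr (Set.mem_Iio.2 ?_)
        have h3 := (abs_lt.1 (Real.dist_eq μ (-γ) ▸ Metric.mem_ball.1 h2)).2
        have h4 : r ≤ γ := min_le_right _ _
        linarith
  have hfin : b'.toReal ≤ Q.real (Metric.ball γ η) := by
    have : b'.toReal = 1 - 2 * κ := by rw [hκ]; ring
    linarith
  exact (ENNReal.toReal_le_toReal hbt (measure_ne_top _ _)).1 hfin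

/-- Almost surely, the posterior oscillates between the two points `γ` and `-γ`. -/
theorem ae_limsup_cauchyPosterior_ball_eq_one (hprior : prior.map (fun μ => -μ) = prior)
    (hν : ν.map (fun x => -x) = ν) (hν0 : ν {0} = 0)
    (hint : ∀ μ, Integrable (fun y => cauchyLoss y μ) ν) (hγ : 0 < γ)
    (hmin : ∀ μ, μ ≠ γ → μ ≠ -γ → ∫ y, cauchyLoss y γ ∂ν < ∫ y, cauchyLoss y μ ∂ν) :
    ∀ᵐ y ∂seqLaw ν, ∀ η, 0 < η →
      limsup (fun n => cauchyPosterior prior y n (Metric.ball γ η)) atTop = 1 ∧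
      limsup (fun n => cauchyPosterior prior y n (Metric.ball (-γ) η)) atTop = 1 := by
  have hpos : ∀ᵐ y ∂seqLaw ν, ∀ η, 0 < η →
      limsup (fun n => cauchyPosterior prior y n (Metric.ball γ η)) atTop = 1 := by
    filter_upwards [ae_mem_positiveDominates hprior hν hν0 hint hγ hmin,
      ae_tendsto_cauchyPosterior_compl_balls (prior := prior) hint hmin] with y h1 h2 η hη
    exact limsup_cauchyPosterior_ball_eq_one hγ h1 h2 hη
  -- By reflection invariance, the result for `γ` also holds almost surely for the negated data,
  -- whose posterior is the mirror image.
  have hneg : ∀ᵐ y ∂seqLaw ν, ∀ η, 0 < η →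
      limsup (fun n => cauchyPosterior prior (fun i => -y i) n (Metric.ball γ η)) atTop = 1 := by
    rw [← map_neg_seqLaw ν hν] at hpos
    exact ae_of_ae_map (f := fun (y : ℕ → ℝ) i => -y i)
      (measurable_pi_lambda _ fun i => (measurable_pi_apply i).neg).aemeasurable hpos
  filter_upwards [hpos, hneg] with y h1 h2 η hη
  refine ⟨h1 η hη, ?_⟩
  have := h2 η hη
  simpa only [cauchyPosterior_neg hprior y _ Metric.isOpen_ball.measurableSet,
    preimage_neg_ball] using this

end Oscillation

/-! ### Symmetry of the mixture, and transfer from the product space to an arbitrary sample. -/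

lemma map_neg_cauchyMeasure (b : ℝ) :
    (cauchyMeasure b 1).map (fun x => -x) = cauchyMeasure (-b) 1 := by
  ext s hs
  rw [Measure.map_apply measurable_neg hs, cauchyMeasure_one, cauchyMeasure_one,
    withDensity_apply _ (measurable_neg hs), withDensity_apply _ hs,
    ← (Measure.measurePreserving_neg (volume : Measure ℝ)).setLIntegral_comp_preimage_emb
      (MeasurableEquiv.neg ℝ).measurableEmbedding (cauchyPDF (-b) 1) s]
  refine lintegral_congr fun x => ?_
  rw [cauchyPDF, cauchyPDF, cauchyPDFReal_one, cauchyPDFReal_one]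
  congr 4
  ring

lemma map_neg_cauchyMixture_half (a : ℝ) :
    (cauchyMixture a (1 / 2)).map (fun x => -x) = cauchyMixture a (1 / 2) := by
  rw [cauchyMixture, Measure.map_add _ _ measurable_neg, Measure.map_smul, Measure.map_smul,
    map_neg_cauchyMeasure, map_neg_cauchyMeasure, neg_neg, add_comm]
  norm_num

lemma cauchyMixture_singleton (a p x : ℝ) : cauchyMixture a p {x} = 0 := by
  have h : ∀ b, cauchyMeasure b 1 {x} = 0 := fun b => by
    rw [cauchyMeasure_one]
    exact withDensity_absolutelyContinuous _ _ (by simp)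
  simp [cauchyMixture, h]

lemma IsCauchyMixtureSample.hasLaw {Ω : Type*} [MeasurableSpace Ω] {P : Measure Ω}
    {Y : ℕ → Ω → ℝ} {a p : ℝ} (h : IsCauchyMixtureSample P Y a p)
    [IsProbabilityMeasure (cauchyMixture a p)] :
    HasLaw (fun ω i => Y i ω) (seqLaw (cauchyMixture a p)) P :=
  iIndepFun.hasLaw_infinitePi h.2 h.1 (aemeasurable_pi_lambda _ fun i => (h.2 i).aemeasurable)

lemma IsCauchyMixtureSample.ae_of_ae {Ω : Type*} [MeasurableSpace Ω] {P : Measure Ω}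
    {Y : ℕ → Ω → ℝ} {a p : ℝ} (h : IsCauchyMixtureSample P Y a p)
    [IsProbabilityMeasure (cauchyMixture a p)] {q : (ℕ → ℝ) → Prop}
    (hq : ∀ᵐ y ∂seqLaw (cauchyMixture a p), q y) : ∀ᵐ ω ∂P, q fun i => Y i ω :=
  ae_of_ae_map h.hasLaw.aemeasurable (by rwa [h.hasLaw.map_eq])

lemma setOf_abs_sub_lt (c η : ℝ) : {μ : ℝ | |μ - c| < η} = Metric.ball c η := by
  ext μ; simp [Real.dist_eq]

lemma setOf_abs_add_lt (c η : ℝ) : {μ : ℝ | |μ + c| < η} = Metric.ball (-c) η := by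
  ext μ; simp [Real.dist_eq]

lemma exists_expectedLogDensity_lt {a p : ℝ} (ha : 2 < a) (hp : 1 / 2 < p) (hp1 : p ≤ 1) :
    ∃ γ, ∀ μ, μ ≠ γ → expectedLogDensity a p μ < expectedLogDensity a p γ := by
  obtain ⟨γ, hγ⟩ := exists_mixtureExpectedLoss_lt ha hp hp1
  refine ⟨γ, fun μ hμ => ?_⟩
  rw [expectedLogDensity_eq a μ (by linarith) hp1, expectedLogDensity_eq a γ (by linarith) hp1]
  linarith [hγ μ hμ]

theorem theorem3 :
    -- Part (a): a point `γ p₀ a`, which does not depend on the prior or on the sample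
    (∃ γ : ℝ → ℝ → ℝ, ∀ a p₀ : ℝ, 2 < a → 1 / 2 < p₀ → p₀ ≤ 1 →
      (∀ μ : ℝ, μ ≠ γ p₀ a → expectedLogDensity a p₀ μ < expectedLogDensity a p₀ (γ p₀ a)) ∧
      ∀ (prior : Measure ℝ) [prior.IsOpenPosMeasure] [prior.HasTemperateGrowth]
        (Ω : Type*) [MeasurableSpace Ω] (P : Measure Ω) [IsProbabilityMeasure P]
        (Y : ℕ → Ω → ℝ), IsCauchyMixtureSample P Y a p₀ →
        ∀ᵐ ω ∂P,
          (∀ᶠ n in atTop, IsProbabilityMeasure (cauchyPosterior prior (fun i => Y i ω) n)) ∧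
          ∀ f : BoundedContinuousFunction ℝ ℝ,
            Tendsto (fun n => ∫ μ, f μ ∂cauchyPosterior prior (fun i => Y i ω) n) atTop
              (𝓝 (f (γ p₀ a)))) ∧
    -- Parts (b) and (c): symmetric prior and equal mixture weights
    (∀ (a : ℝ), 2 < a →
      ∀ (prior : Measure ℝ) [prior.IsOpenPosMeasure] [prior.HasTemperateGrowth],
        prior.map (fun μ => -μ) = prior →
      ∀ (Ω : Type*) [MeasurableSpace Ω] (P : Measure Ω) [IsProbabilityMeasure P]
        (Y : ℕ → Ω → ℝ), IsCauchyMixtureSample P Y a (1 / 2) →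
        -- almost surely, the posterior charges asymptotically only the two points
        (∀ᵐ ω ∂P,
          (∀ᶠ n in atTop, IsProbabilityMeasure (cauchyPosterior prior (fun i => Y i ω) n)) ∧
          ∀ η : ℝ, 0 < η →
            Tendsto (fun n => cauchyPosterior prior (fun i => Y i ω) n
              {μ | |μ - √(a ^ 2 - 4)| < η ∨ |μ + √(a ^ 2 - 4)| < η}) atTop (𝓝 1)) ∧
        -- each of the two points is selected with asymptotic probability `1 / 2`: the posterior
        -- mass near it converges in distribution to a Bernoulli(1 / 2) variable
        (∀ η : ℝ, 0 < η → η < 2 * √(a ^ 2 - 4) → ∀ t : ℝ, 0 < t → t < 1 →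
          Tendsto (fun n => P.real {ω | t < (cauchyPosterior prior (fun i => Y i ω) n).real
            {μ | |μ - √(a ^ 2 - 4)| < η}}) atTop (𝓝 (1 / 2)) ∧
          Tendsto (fun n => P.real {ω | t < (cauchyPosterior prior (fun i => Y i ω) n).real
            {μ | |μ + √(a ^ 2 - 4)| < η}}) atTop (𝓝 (1 / 2))) ∧
        -- almost surely, the posterior oscillates between the two points
        (∀ᵐ ω ∂P, ∀ η : ℝ, 0 < η →
          limsup (fun n => cauchyPosterior prior (fun i => Y i ω) n
            {μ | |μ - √(a ^ 2 - 4)| < η}) atTop = 1 ∧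
          limsup (fun n => cauchyPosterior prior (fun i => Y i ω) n
            {μ | |μ + √(a ^ 2 - 4)| < η}) atTop = 1)) := by
  constructor
  -- The maximizer is chosen from `p` and `a` alone, before the prior and the sample appear; outside
  -- the admissible range its value is arbitrary.
  · choose! γ hγ using fun (p : ℝ) (hp : 1 / 2 < p) (hp1 : p ≤ 1) (a : ℝ) (ha : 2 < a) =>
      exists_expectedLogDensity_lt ha hp hp1
    refine ⟨γ, fun a p ha hp hp1 => ⟨hγ p hp hp1 a ha, ?_⟩⟩
    intro prior _ _ Ω _ P _ Y hY
    have hp0 : 0 ≤ p := by linarith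
    have := isProbabilityMeasure_cauchyMixture a hp0 hp1
    filter_upwards [hY.ae_of_ae (ae_tendsto_totalLoss_div _
      (integrable_cauchyLoss_cauchyMixture a p))] with ω hω
    obtain ⟨m, hm⟩ := eventually_isProbabilityMeasure_cauchyPosterior prior
    refine ⟨eventually_atTop.2 ⟨m, fun n hn => hm _ n hn⟩, fun f => ?_⟩
    refine tendsto_integral_cauchyPosterior prior hω (fun μ hμ => ?_) f
    have h := hγ p hp hp1 a ha μ hμ
    rw [expectedLogDensity_eq a μ hp0 hp1, expectedLogDensity_eq a _ hp0 hp1] at h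
    simp only [mixtureExpectedLoss] at h
    linarith
  · intro a ha prior _ _ hprior Ω _ P _ Y hY
    have := isProbabilityMeasure_cauchyMixture a (p := 1 / 2) (by norm_num) (by norm_num)
    set γ := √(a ^ 2 - 4) with hγdef
    have hpos : 0 < a ^ 2 - 4 := by nlinarith
    have hγ : 0 < γ := Real.sqrt_pos.2 hpos
    have hγ2 : γ ^ 2 = a ^ 2 - 4 := Real.sq_sqrt hpos.le
    have hν := map_neg_cauchyMixture_half a
    have hν0 := cauchyMixture_singleton a (1 / 2) 0
    have hint := integrable_cauchyLoss_cauchyMixture a (1 / 2)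
    have hmin : ∀ μ, μ ≠ γ → μ ≠ -γ → ∫ y, cauchyLoss y γ ∂cauchyMixture a (1 / 2) <
        ∫ y, cauchyLoss y μ ∂cauchyMixture a (1 / 2) :=
      fun μ h1 h2 => mixtureExpectedLoss_half_lt hγ2 h1 h2
    simp only [Set.ofPred_or, setOf_abs_sub_lt, setOf_abs_add_lt]
    refine ⟨?_, fun η hη hηγ t ht0 ht1 => ?_, ?_⟩
    · obtain ⟨m, hm⟩ := eventually_isProbabilityMeasure_cauchyPosterior prior
      filter_upwards [hY.ae_of_ae (ae_tendsto_cauchyPosterior_compl_balls (prior := prior)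
        hint hmin)] with ω hω
      refine ⟨eventually_atTop.2 ⟨m, fun n hn => hm _ n hn⟩, fun η hη => ?_⟩
      have h := ENNReal.Tendsto.sub (tendsto_const_nhds (x := (1 : ENNReal))) (hω η hη)
        (Or.inl ENNReal.one_ne_top)
      rw [tsub_zero] at h
      refine h.congr' ?_
      filter_upwards [eventually_ge_atTop m] with n hn
      have := hm (fun i => Y i ω) n hn
      rw [prob_compl_eq_one_sub (Metric.isOpen_ball.union Metric.isOpen_ball).measurableSet,
        ENNReal.sub_sub_cancel ENNReal.one_ne_top prob_le_one]
    · obtain ⟨h1, h2⟩ := tendsto_measure_lt_cauchyPosterior_ball (prior := prior) hprior hν hν0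
        hint hγ hmin hη hηγ ht0 ht1
      have htrans : ∀ c n, P.real {ω | t <
          (cauchyPosterior prior (fun i => Y i ω) n).real (Metric.ball c η)} =
          (seqLaw (cauchyMixture a (1 / 2))).real {y | t <
            (cauchyPosterior prior y n).real (Metric.ball c η)} := fun c n =>
        hY.hasLaw.measureReal_eq (p := fun y => t <
            (cauchyPosterior prior y n).real (Metric.ball c η)) (measurableSet_lt measurable_const
          (measurable_real_cauchyPosterior n Metric.isOpen_ball.measurableSet))
      exact ⟨h1.congr fun n => (htrans γ n).symm, h2.congr fun n => (htrans (-γ) n).symm⟩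
    · exact hY.ae_of_ae (ae_limsup_cauchyPosterior_ball_eq_one (prior := prior) hprior hν hν0
        hint hγ hmin)
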